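/- Let $d$ be a dimension. For $\tau>0$ let $\gamma_\tau$ be the centred Gaussian measure on $\mathbb R^d$ with density $(2\pi\tau)^{-d/2}\exp(-|x|^2/(2\tau))$ with respect to Lebesgue measure, and put $\gamma:=\gamma_1$; all $L^p$-spaces consist of complex-valued functions. Let $L$ be the Ornstein–Uhlenbeck operator on $L^2(\mathbb R^d,\gamma)$, i.e. the closure of the operator $f\mapsto -\Delta f+x\cdot\nabla f$ with domain $C_c^2(\mathbb R^d)$. Then $-L$ generates a strongly continuous semigroup $(\exp(-tL))_{t\ge 0}$ on $L^2(\mathbb R^d,\gamma)$. For $1\le p\le 2$, $t>0$, set $$\alpha_{p,t}:=\frac{1+e^{-2t}}{p}.$$ We say that $\exp(-tL)$ is bounded from $L^p(\mathbb R^d,\gamma_\alpha)$ to $L^2(\mathbb R^d,\gamma)$ with norm at most $K$ if there is a bounded linear operator $S:L^p(\mathbb R^d,\gamma_\alpha)\to L^2(\mathbb R^d,\gamma)$ with $\|S\|\le K$ such that $Sf=\exp(-tL)f$ for all $f\in L^p(\mathbb R^d,\gamma_\alpha)\cap L^2(\mathbb R^d,\gamma)$. 1. There is a constant $C$, depending only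 on $d$, such that for all $t>0$ the operator $\exp(-tL)$ is bounded from $L^1(\mathbb R^d,\gamma_{\alpha_{1,t}})$ to $L^2(\mathbb R^d,\gamma)$ with norm at most $C\,(1-e^{-4t})^{-d/4}$. 2. For all $p\in[1,2]$ and all $t>0$ the operator $\exp(-tL)$ is bounded from $L^p(\mathbb R^d,\gamma_{\alpha_{p,t}})$ to $L^2(\mathbb R^d,\gamma)$. Moreover, for each $p\in[1,2]$ there are constants $C$ and $t_0>0$, depending only on $d$ and $p$, such that for $0<t<t_0$ the norm is at most $C\,t^{-\frac d2\left(\frac1p-\frac12\right)}$. -/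

import Mathlib

open Filter MeasureTheory Set
open scoped Topology ENNReal Laplacian

/-- Euclidean space `ℝ^d`. -/
abbrev EucSpace (d : ℕ) : Type := EuclideanSpace ℝ (Fin d)

/-! ### Strongly continuous semigroups and their generators -/

section Semigroup

/-- `T` (considered for times `t ≥ 0`) is a strongly continuous one-parameter semigroup of bounded
operators on `H`. -/
structure IsC0Semigroup {H : Type*} [NormedAddCommGroup H] [NormedSpace ℂ H]
    (T : ℝ → H →L[ℂ] H) : Prop where
  map_zero : T 0 = ContinuousLinearMap.id ℂ H
  map_add : ∀ s t : ℝ, 0 ≤ s → 0 ≤ t → T (s + t) = (T s).comp (T t)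
  strongly_continuous : ∀ f : H, ContinuousOn (fun t : ℝ => T t f) (Ici 0)

/-- The (in general unbounded) operator `A` is the infinitesimal generator of `T`: one has
`f ∈ D(A)` and `A f = g` if and only if `(T t f - f) / t → g` as `t ↓ 0`. -/
def IsGeneratorOf {H : Type*} [NormedAddCommGroup H] [NormedSpace ℂ H]
    (A : H →ₗ.[ℂ] H) (T : ℝ → H →L[ℂ] H) : Prop :=
  ∀ f g : H, (f, g) ∈ A.graph ↔
    Tendsto (fun t : ℝ => t⁻¹ • (T t f - f)) (𝓝[>] 0) (𝓝 g)

/-- `T` is a strongly continuous semigroup whose generator is `A`. -/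
def IsC0SemigroupGeneratedBy {H : Type*} [NormedAddCommGroup H] [NormedSpace ℂ H]
    (T : ℝ → H →L[ℂ] H) (A : H →ₗ.[ℂ] H) : Prop :=
  IsC0Semigroup T ∧ IsGeneratorOf A T

open Classical in
/-- The operators `exp (t A)`, `t ≥ 0`: the strongly continuous semigroup generated by `A`
(and `0` if `A` is not the generator of such a semigroup). By `IsC0SemigroupGeneratedBy.unique`
below there is at most one such semigroup. -/
noncomputable def expSemigroup {H : Type*} [NormedAddCommGroup H] [NormedSpace ℂ H]
    (A : H →ₗ.[ℂ] H) : ℝ → H →L[ℂ] H :=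
  if h : ∃ T : ℝ → H →L[ℂ] H, IsC0SemigroupGeneratedBy T A then h.choose else fun _ => 0

variable {H : Type*} [NormedAddCommGroup H] [NormedSpace ℂ H]

theorem expSemigroup_spec {A : H →ₗ.[ℂ] H} {T : ℝ → H →L[ℂ] H}
    (hT : IsC0SemigroupGeneratedBy T A) : IsC0SemigroupGeneratedBy (expSemigroup A) A := by
  have h : ∃ T : ℝ → H →L[ℂ] H, IsC0SemigroupGeneratedBy T A := ⟨T, hT⟩
  rw [expSemigroup, dif_pos h]
  exact h.choose_spec

theorem IsC0Semigroup.bounded_Icc [CompleteSpace H] {T : ℝ → H →L[ℂ] H} (hT : IsC0Semigroup T)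
    (a : ℝ) : ∃ M : ℝ, 0 ≤ M ∧ ∀ t ∈ Icc (0 : ℝ) a, ‖T t‖ ≤ M := by
  have h : ∃ C, ∀ i : Icc (0 : ℝ) a, ‖T i‖ ≤ C := by
    apply banach_steinhaus
    intro x
    have hc : ContinuousOn (fun t : ℝ => T t x) (Icc 0 a) :=
      (hT.strongly_continuous x).mono Icc_subset_Ici_self
    obtain ⟨C, hC⟩ := isCompact_Icc.exists_bound_of_continuousOn hc
    exact ⟨C, fun i => hC i i.2⟩
  obtain ⟨C, hC⟩ := h
  exact ⟨max C 0, le_max_right _ _, fun t ht => (hC ⟨t, ht⟩).trans (le_max_left _ _)⟩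

theorem IsC0SemigroupGeneratedBy.mem_graph_apply {A : H →ₗ.[ℂ] H} {T : ℝ → H →L[ℂ] H}
    (hT : IsC0SemigroupGeneratedBy T A) {s : ℝ} (hs : 0 ≤ s) {f g : H} (hfg : (f, g) ∈ A.graph) :
    (T s f, T s g) ∈ A.graph := by
  rw [hT.2] at hfg ⊢
  have h := ((T s).continuous.tendsto g).comp hfg
  refine h.congr' ?_
  filter_upwards [self_mem_nhdsWithin] with t ht
  have h1 : T t (T s f) = T s (T t f) := by
    rw [← ContinuousLinearMap.comp_apply, ← ContinuousLinearMap.comp_apply,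
      ← hT.1.map_add t s (le_of_lt ht) hs, ← hT.1.map_add s t hs (le_of_lt ht), add_comm]
  have h2 : T s (t⁻¹ • (T t f - f)) = t⁻¹ • T s (T t f - f) :=
    map_real_smul (T s) (T s).continuous _ _
  simp only [Function.comp_apply, h2, h1, map_sub]

/-- Two semigroups with the same generator agree on the domain of the generator. -/
theorem IsC0SemigroupGeneratedBy.eq_on_domain [CompleteSpace H] {A : H →ₗ.[ℂ] H}
    {T S : ℝ → H →L[ℂ] H} (hT : IsC0SemigroupGeneratedBy T A) (hS : IsC0SemigroupGeneratedBy S A)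
    {t : ℝ} (ht : 0 ≤ t) {f g : H} (hfg : (f, g) ∈ A.graph) : T t f = S t f := by
  obtain ⟨M, hM0, hM⟩ := hT.1.bounded_Icc t
  have key : ∀ s ∈ Icc (0 : ℝ) t, T (t - s) (S s f) = T (t - 0) (S 0 f) := by
    apply constant_of_has_deriv_right_zero
    · -- continuity
      intro s hs
      have hTc : ContinuousWithinAt (fun r : ℝ => T (t - r) (S s f)) (Icc 0 t) s := by
        have h1 := hT.1.strongly_continuous (S s f) (t - s) (by simp [hs.2])
        refine ContinuousWithinAt.comp (t := Ici 0) (f := fun r : ℝ => t - r) h1 ?_ ?_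
        · exact (continuous_const.sub continuous_id).continuousWithinAt
        · intro r hr
          simp [hr.2]
      have hSc : ContinuousWithinAt (fun r : ℝ => S r f) (Icc 0 t) s :=
        ((hS.1.strongly_continuous f) s hs.1).mono Icc_subset_Ici_self
      have h0 : Tendsto (fun r : ℝ => T (t - r) (S r f - S s f)) (𝓝[Icc 0 t] s) (𝓝 0) := by
        have h3 : Tendsto (fun r : ℝ => M * ‖S r f - S s f‖) (𝓝[Icc 0 t] s) (𝓝 0) := by
          have := (tendsto_iff_norm_sub_tendsto_zero.1 hSc).const_mul M
          simpa using this
        refine squeeze_zero_norm' ?_ h3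
        filter_upwards [self_mem_nhdsWithin] with r hr
        exact (T (t - r)).le_of_opNorm_le (hM _ ⟨by linarith [hr.2], by linarith [hr.1]⟩) _
      have h4 := h0.add hTc
      simp only [zero_add] at h4
      refine h4.congr fun r => ?_
      simp
    · intro s hs
      have hmem := hS.mem_graph_apply hs.1 hfg
      have hA := (hT.2 _ _).1 hmem
      have hB := (hS.2 _ _).1 hmem
      have hd : Tendsto (fun h : ℝ => h⁻¹ • (S h (S s f) - T h (S s f))) (𝓝[>] 0) (𝓝 0) := by
        have h5 := hB.sub hA
        rw [sub_self] at h5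
        refine h5.congr fun h => ?_
        rw [← smul_sub]
        congr 1
        abel
      rw [← hasDerivWithinAt_Ioi_iff_Ici, hasDerivWithinAt_iff_tendsto_slope' (by simp)]
      have hsub : Tendsto (fun r : ℝ => r - s) (𝓝[>] s) (𝓝[>] 0) := by
        apply tendsto_nhdsWithin_of_tendsto_nhds_of_eventually_within
        · have : Tendsto (fun r : ℝ => r - s) (𝓝 s) (𝓝 (s - s)) :=
            (continuous_id.sub continuous_const).tendsto s
          rw [sub_self] at this
          exact this.mono_left nhdsWithin_le_nhds
        · filter_upwards [self_mem_nhdsWithin] with r hr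
          exact sub_pos.2 (mem_Ioi.1 hr)
      have hd' := (hd.comp hsub).norm.const_mul M
      simp only [norm_zero, mul_zero] at hd'
      refine squeeze_zero_norm' ?_ hd'
      filter_upwards [self_mem_nhdsWithin, Ioc_mem_nhdsGT hs.2] with r hr hr2
      have hrs : (0 : ℝ) ≤ r - s := (sub_pos.2 hr).le
      have e1 : S r f = S (r - s) (S s f) := by
        rw [← ContinuousLinearMap.comp_apply, ← hS.1.map_add _ _ hrs hs.1, sub_add_cancel]
      have e2 : T (t - s) (S s f) = T (t - r) (T (r - s) (S s f)) := by
        have e4 : t - s = (t - r) + (r - s) := by ring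
        rw [e4, hT.1.map_add _ _ (sub_nonneg.2 hr2.2) hrs, ContinuousLinearMap.comp_apply]
      have e3 : slope (fun s => T (t - s) (S s f)) s r
          = T (t - r) ((r - s)⁻¹ • (S (r - s) (S s f) - T (r - s) (S s f))) := by
        rw [slope_def_module, e2, e1, ← map_sub]
        exact (map_real_smul (T (t - r)) (T (t - r)).continuous _ _).symm
      rw [e3]
      exact (T (t - r)).le_of_opNorm_le
        (hM _ ⟨by linarith [hr2.2], by linarith [hs.1, hr2.1]⟩) _
  have h1 := key t ⟨ht, le_rfl⟩
  rw [sub_self, sub_zero, hT.1.map_zero, hS.1.map_zero] at h1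
  simpa using h1.symm

theorem tendsto_average_right [CompleteSpace H] {u : ℝ → H} (hu : ContinuousOn u (Ici 0)) {a : ℝ}
    (ha : 0 ≤ a) : Tendsto (fun h : ℝ => h⁻¹ • ∫ r in a..(a + h), u r) (𝓝[>] 0) (𝓝 (u a)) := by
  have hc : ContinuousWithinAt u (Ioi a) a :=
    (hu a ha).mono (fun x hx => ha.trans (le_of_lt hx))
  have hm : StronglyMeasurableAtFilter u (𝓝[>] a) volume :=
    ⟨Ioi a, self_mem_nhdsWithin, (hu.mono (fun x hx => ha.trans (le_of_lt hx))).aestronglyMeasurable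
      measurableSet_Ioi⟩
  have hd : HasDerivWithinAt (fun x => ∫ r in a..x, u r) (u a) (Ici a) a :=
    intervalIntegral.integral_hasDerivWithinAt_right (by simp) hm hc
  rw [← hasDerivWithinAt_Ioi_iff_Ici, hasDerivWithinAt_iff_tendsto_slope' (by simp)] at hd
  have hadd : Tendsto (fun h : ℝ => a + h) (𝓝[>] 0) (𝓝[>] a) := by
    apply tendsto_nhdsWithin_of_tendsto_nhds_of_eventually_within
    · have : Tendsto (fun h : ℝ => a + h) (𝓝 0) (𝓝 (a + 0)) :=
        (continuous_const.add continuous_id).tendsto 0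
      rw [add_zero] at this
      exact this.mono_left nhdsWithin_le_nhds
    · filter_upwards [self_mem_nhdsWithin] with r hr
      simpa using hr
  refine (hd.comp hadd).congr fun h => ?_
  simp [slope_def_module]

/-- The domain of the generator is dense. -/
theorem IsC0SemigroupGeneratedBy.dense_domain [CompleteSpace H] {A : H →ₗ.[ℂ] H}
    {T : ℝ → H →L[ℂ] H} (hT : IsC0SemigroupGeneratedBy T A) : Dense (A.domain : Set H) := by
  intro f
  have hu := hT.1.strongly_continuous f
  have hint : ∀ a b : ℝ, 0 ≤ a → 0 ≤ b → IntervalIntegrable (fun r => T r f) volume a b := by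
    intro a b ha hb
    exact (hu.mono (fun x hx => (le_inf ha hb).trans hx.1)).intervalIntegrable
  have hlim : Tendsto (fun h : ℝ => h⁻¹ • ∫ r in (0 : ℝ)..h, T r f) (𝓝[>] 0) (𝓝 f) := by
    have := tendsto_average_right hu le_rfl
    simpa [hT.1.map_zero] using this
  refine mem_closure_of_tendsto hlim ?_
  filter_upwards [self_mem_nhdsWithin] with h hh
  have hh0 : (0 : ℝ) ≤ h := le_of_lt hh
  suffices hs : (∫ r in (0 : ℝ)..h, T r f, T h f - f) ∈ A.graph by
    have hmem : (∫ r in (0 : ℝ)..h, T r f) ∈ A.domain := LinearPMap.mem_domain_of_mem_graph hs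
    have : h⁻¹ • (∫ r in (0 : ℝ)..h, T r f) = ((h⁻¹ : ℝ) : ℂ) • (∫ r in (0 : ℝ)..h, T r f) :=
      (Complex.coe_smul _ _).symm
    rw [this]
    exact A.domain.smul_mem _ hmem
  rw [hT.2]
  have h1 := (tendsto_average_right hu hh0).sub (tendsto_average_right hu le_rfl)
  rw [hT.1.map_zero] at h1
  refine h1.congr' ?_
  filter_upwards [self_mem_nhdsWithin] with e he
  have he0 : (0 : ℝ) ≤ e := le_of_lt he
  have e1 : T e (∫ r in (0 : ℝ)..h, T r f) = ∫ r in (0 : ℝ)..h, T (r + e) f := by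
    rw [← ContinuousLinearMap.intervalIntegral_comp_comm _ (hint 0 h le_rfl hh0)]
    apply intervalIntegral.integral_congr
    intro r hr
    rw [uIcc_of_le hh0] at hr
    have := hT.1.map_add e r he0 hr.1
    simp only [add_comm r e, this, ContinuousLinearMap.comp_apply]
  have e2 : ∫ r in (0 : ℝ)..h, T (r + e) f = ∫ r in e..(h + e), T r f := by
    rw [intervalIntegral.integral_comp_add_right (fun r => T r f) e, zero_add]
  have e3 : (∫ r in (0 : ℝ)..e, T r f) + ∫ r in e..(h + e), T r f
      = (∫ r in (0 : ℝ)..h, T r f) + ∫ r in h..(h + e), T r f := by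
    rw [intervalIntegral.integral_add_adjacent_intervals (hint _ _ le_rfl he0)
      (hint _ _ he0 (by linarith)), intervalIntegral.integral_add_adjacent_intervals
      (hint _ _ le_rfl hh0) (hint _ _ hh0 (by linarith))]
  rw [e1, e2, ← smul_sub, zero_add, ← sub_eq_zero, ← smul_sub]
  rw [smul_eq_zero]
  right
  rw [sub_eq_zero, sub_eq_sub_iff_add_eq_add, add_comm, ← e3, add_comm]

/-- A strongly continuous semigroup is determined by its generator. -/
theorem IsC0SemigroupGeneratedBy.unique [CompleteSpace H] {A : H →ₗ.[ℂ] H}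
    {T S : ℝ → H →L[ℂ] H} (hT : IsC0SemigroupGeneratedBy T A) (hS : IsC0SemigroupGeneratedBy S A)
    {t : ℝ} (ht : 0 ≤ t) : T t = S t := by
  refine ContinuousLinearMap.ext fun x => ?_
  have h := Continuous.ext_on hT.dense_domain (T t).continuous (S t).continuous (fun f hf => by
    obtain ⟨g, hg⟩ := LinearPMap.mem_domain_iff.1 hf
    exact hT.eq_on_domain hS ht hg)
  exact congrFun h x

end Semigroup

/-! ### Gaussian measures and the Ornstein-Uhlenbeck operator -/

/-- The centred Gaussian measure `γ_τ` on `ℝ^d`, with density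
`(2πτ)^{-d/2} exp (-|x|² / (2τ))` with respect to Lebesgue measure. -/
noncomputable def gaussMeasure (d : ℕ) (τ : ℝ) : Measure (EucSpace d) :=
  volume.withDensity fun x =>
    ENNReal.ofReal ((2 * Real.pi * τ) ^ (-((d : ℝ) / 2)) * Real.exp (-(‖x‖ ^ 2 / (2 * τ))))

/-- The complex Hilbert space `L²(ℝ^d, γ)`, with `γ = γ_1` the standard Gaussian measure. -/
abbrev GaussL2 (d : ℕ) : Type := Lp ℂ 2 (gaussMeasure d 1)

/-- The differential expression `-Δ f + x · ∇ f`. -/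
noncomputable def ouExpr {d : ℕ} (f : EucSpace d → ℂ) (x : EucSpace d) : ℂ :=
  -(Δ f) x + fderiv ℝ f x x

/-- The graph of `f ↦ -Δ f + x · ∇ f` on `C_c²(ℝ^d)`, as a subspace of `L²(γ) × L²(γ)`. -/
noncomputable def ouCoreGraph (d : ℕ) : Submodule ℂ (GaussL2 d × GaussL2 d) where
  carrier := {u | ∃ f : EucSpace d → ℂ, ContDiff ℝ 2 f ∧ HasCompactSupport f ∧
    u.1 =ᵐ[gaussMeasure d 1] f ∧ u.2 =ᵐ[gaussMeasure d 1] ouExpr f}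
  zero_mem' := by
    refine ⟨0, contDiff_const, HasCompactSupport.zero, Lp.coeFn_zero _ _ _, ?_⟩
    have : ouExpr (0 : EucSpace d → ℂ) = 0 := by
      funext x
      have h0 : (0 : EucSpace d → ℂ) = fun _ => (0 : ℂ) := rfl
      simp [ouExpr, h0, InnerProductSpace.laplacian_const]
    rw [this]
    exact Lp.coeFn_zero _ _ _
  add_mem' := by
    rintro u v ⟨f, hf, hfc, hf1, hf2⟩ ⟨g, hg, hgc, hg1, hg2⟩
    refine ⟨f + g, hf.add hg, hfc.add hgc, ?_, ?_⟩
    · exact (Lp.coeFn_add _ _).trans (hf1.add hg1)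
    · refine (Lp.coeFn_add _ _).trans ((hf2.add hg2).trans (Eventually.of_forall fun x => ?_))
      simp only [ouExpr, Pi.add_apply]
      rw [hf.contDiffAt.laplacian_add hg.contDiffAt,
        fderiv_add (hf.differentiable (by norm_num) x) (hg.differentiable (by norm_num) x)]
      simp only [add_apply]
      ring
  smul_mem' := by
    rintro c u ⟨f, hf, hfc, hf1, hf2⟩
    refine ⟨c • f, hf.const_smul c, hfc.smul_left (f := fun _ => c), ?_, ?_⟩
    · exact (Lp.coeFn_smul _ _).trans (hf1.const_smul c)
    · refine (Lp.coeFn_smul _ _).trans ((hf2.const_smul c).trans (Eventually.of_forall fun x => ?_))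
      simp only [ouExpr, Pi.smul_apply]
      rw [InnerProductSpace.laplacian_smul c hf.contDiffAt,
        fderiv_const_smul (hf.differentiable (by norm_num) x)]
      simp only [smul_apply, smul_eq_mul]
      ring

theorem ae_gaussMeasure_iff {d : ℕ} {τ : ℝ} (hτ : 0 < τ) {P : EucSpace d → Prop} :
    (∀ᵐ x ∂(gaussMeasure d τ), P x) ↔ ∀ᵐ x, P x := by
  rw [gaussMeasure, ae_withDensity_iff (by fun_prop)]
  have h : ∀ x : EucSpace d, ENNReal.ofReal ((2 * Real.pi * τ) ^ (-((d : ℝ) / 2)) *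
      Real.exp (-(‖x‖ ^ 2 / (2 * τ)))) ≠ 0 := fun x => by
    have : 0 < (2 * Real.pi * τ) ^ (-((d : ℝ) / 2)) * Real.exp (-(‖x‖ ^ 2 / (2 * τ))) := by
      positivity
    simpa using this
  simp [h]

/-- The relation `ouCoreGraph` is single-valued, hence the graph of an operator. -/
theorem ouCoreGraph_single_valued (d : ℕ) :
    ∀ u : GaussL2 d × GaussL2 d, u ∈ ouCoreGraph d → u.1 = 0 → u.2 = 0 := by
  rintro u ⟨f, hf, -, hf1, hf2⟩ hu
  have h0 : f =ᵐ[volume] (fun _ => (0 : ℂ)) := by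
    have h1 : ∀ᵐ x ∂(gaussMeasure d 1), f x = 0 := by
      have hz := Lp.coeFn_zero ℂ 2 (gaussMeasure d 1)
      rw [hu] at hf1
      filter_upwards [hf1, hz] with x h1 h2
      rw [← h1, h2, Pi.zero_apply]
    exact (ae_gaussMeasure_iff one_pos).1 h1
  have hf0 : f = fun _ => (0 : ℂ) := (hf.continuous.ae_eq_iff_eq volume continuous_const).1 h0
  have he : ouExpr f = 0 := by
    funext x
    simp [ouExpr, hf0]
  rw [he] at hf2
  exact (Lp.eq_zero_iff_ae_eq_zero).2 hf2

/-- The Ornstein-Uhlenbeck operator `L = -Δ + x · ∇` on `L²(γ)`, as a closed unbounded operator: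
the closure of `f ↦ -Δ f + x · ∇ f` with domain `C_c²(ℝ^d)`. -/
noncomputable def ouOperator (d : ℕ) : GaussL2 d →ₗ.[ℂ] GaussL2 d :=
  (ouCoreGraph d).toLinearPMap.closure

theorem ouCore_graph (d : ℕ) : (ouCoreGraph d).toLinearPMap.graph = ouCoreGraph d :=
  Submodule.toLinearPMap_graph_eq _ (ouCoreGraph_single_valued d)

/-- The operator `exp (-t L)` on `L²(γ)`. -/
noncomputable def ouSemigroup (d : ℕ) (t : ℝ) : GaussL2 d →L[ℂ] GaussL2 d :=
  expSemigroup (-ouOperator d) t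

/-! ### Boundedness from `L^p(γ_α)` to `L²(γ)` -/

/-- The operator `T` on `L²(γ)` is bounded from `L^p(γ_α)` to `L²(γ)` with norm at most `K`: there
is a bounded operator `S : L^p(γ_α) → L²(γ)` of norm at most `K` which coincides with `T` on all
functions belonging to both `L^p(γ_α)` and `L²(γ)`. -/
def IsBoundedLpToL2 {d : ℕ} (T : GaussL2 d →L[ℂ] GaussL2 d) (p : ℝ≥0∞) [Fact (1 ≤ p)] (α K : ℝ) :
    Prop :=
  ∃ S : Lp ℂ p (gaussMeasure d α) →L[ℂ] GaussL2 d, ‖S‖ ≤ K ∧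
    ∀ (g : Lp ℂ p (gaussMeasure d α)) (f : GaussL2 d), g =ᵐ[volume] f → S g = T f

/-- The variance `α_{p,t} = (1 + e^{-2t}) / p`. -/
noncomputable def ouAlpha (p : ℝ≥0∞) (t : ℝ) : ℝ := (1 + Real.exp (-2 * t)) / p.toReal

open scoped RealInnerProductSpace

/-! ### Gaussian measures -/

/-! Mehler's formula writes exp(-tL) as integration against `mehlerKernel`. Multiplying this kernel
by γ(x)^(1/2) and by γ_α(y)^(-1/p) turns a bound from L^p(γ_α) to L²(γ) into an unweighted bound
from L^p(dy) to L²(dx). Put R = e^{-2t}. The value α = (1 + R)/p is the one for which the quadratic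
form in the exponent becomes a perfect square -b|x - ay|², with b = (1 + R)/(4(1 - R)) and a =
2e^{-t}/(1 + R) (`mehlerKernel_weighted`). What remains is a Gaussian convolution combined with a
dilation, and Young's inequality with 1/p + 1/q = 3/2 applies (`lintegral_kernel_sq_le`,
`lintegral_mehlerKernel_sq_le`). The kernel prefactor contributes (1 - R)^(-d/2) and the L^q norm of
the Gaussian (1 - R)^(d/(2q)); together they give (1 - R)^(-(d/2)(1/p - 1/2)). The dilation costs
a^(-d(1 - 1/p)) ≤ e^{td(1 - 1/p)}, which is 1 for p = 1, hence uniformity in t there, and is bounded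
for small t in general.

The semigroup is defined abstractly through its generator, so Mehler's formula must be identified
with it. This is done on the characters e_ξ = exp(i⟨ξ, ·⟩), whose span is dense in L²(γ). The Mehler
operator T_t sends e_ξ to a scalar multiple of e_η with η = e^{-t}ξ, and ⟨e_η, T_t e_ξ⟩ = exp(-(|ξ|²
+ |η|²)/2 + e^{-t}⟨ξ, η⟩); symmetry and the derivative in t are read off from this expression.
Integration by parts makes L symmetric against characters, and cut-offs put the characters in D(L).
Hence T_h f - f = -∫₀ʰ T_s Lf ds on D(L) (`mehlerOp_sub_of_mem_graph`), while ∫₀ʰ T_s f ds lies in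
D(L) for every f (`integral_mehlerOp_mem_graph`). Since L is closed, the generator is exactly -L
(`isGeneratorOf_mehlerOp`), and uniqueness of the generated semigroup concludes. -/

/-- The density of `gaussMeasure d τ`. -/
noncomputable def gaussDensity (d : ℕ) (τ : ℝ) (x : EucSpace d) : ℝ :=
  (2 * Real.pi * τ) ^ (-((d : ℝ) / 2)) * Real.exp (-(‖x‖ ^ 2 / (2 * τ)))

theorem gaussDensity_pos {d : ℕ} {τ : ℝ} (hτ : 0 < τ) (x : EucSpace d) :
    0 < gaussDensity d τ x := by
  unfold gaussDensity; positivity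

theorem continuous_gaussDensity (d : ℕ) (τ : ℝ) : Continuous (gaussDensity d τ) := by
  unfold gaussDensity; fun_prop

theorem lintegral_gaussMeasure {d : ℕ} {τ : ℝ} (f : EucSpace d → ℝ≥0∞) :
    ∫⁻ x, f x ∂(gaussMeasure d τ) = ∫⁻ x, ENNReal.ofReal (gaussDensity d τ x) * f x := by
  rw [gaussMeasure, lintegral_withDensity_eq_lintegral_mul_non_measurable _ (by fun_prop)
    (by simp)]
  rfl

theorem integral_gaussMeasure {d : ℕ} {τ : ℝ} (hτ : 0 < τ) (f : EucSpace d → ℂ) :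
    ∫ x, f x ∂(gaussMeasure d τ) = ∫ x, (gaussDensity d τ x : ℂ) * f x := by
  rw [gaussMeasure, integral_withDensity_eq_integral_toReal_smul (by fun_prop) (by simp)]
  refine integral_congr_ae (Eventually.of_forall fun x => ?_)
  change (ENNReal.ofReal (gaussDensity d τ x)).toReal • f x = _
  rw [ENNReal.toReal_ofReal (gaussDensity_pos hτ x).le, Complex.real_smul]

theorem integrable_gaussMeasure_iff {d : ℕ} {τ : ℝ} (hτ : 0 < τ) (f : EucSpace d → ℂ) :
    Integrable f (gaussMeasure d τ) ↔ Integrable fun x => (gaussDensity d τ x : ℂ) * f x := by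
  rw [gaussMeasure, integrable_withDensity_iff_integrable_smul' (by fun_prop) (by simp)]
  refine integrable_congr (Eventually.of_forall fun x => ?_)
  change (ENNReal.ofReal (gaussDensity d τ x)).toReal • f x = _
  rw [ENNReal.toReal_ofReal (gaussDensity_pos hτ x).le, Complex.real_smul]

theorem gaussMeasure_absolutelyContinuous (d : ℕ) (τ : ℝ) : gaussMeasure d τ ≪ volume :=
  withDensity_absolutelyContinuous _ _

theorem absolutelyContinuous_gaussMeasure {d : ℕ} {τ : ℝ} (hτ : 0 < τ) :
    volume ≪ gaussMeasure d τ := by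
  intro s hs
  have h : ∀ᵐ x ∂(gaussMeasure d τ), x ∉ s := by
    rw [measure_eq_zero_iff_ae_notMem] at hs
    exact hs
  rw [ae_gaussMeasure_iff hτ] at h
  exact (measure_eq_zero_iff_ae_notMem).2 h

/-! ### Characters and Gaussian integrals. -/

/-- The function `exp (-‖x‖² / 2 + i ⟨ξ, x⟩)`. -/
noncomputable def gaussWave {d : ℕ} (ξ x : EucSpace d) : ℂ :=
  Complex.exp (-(‖x‖ : ℂ) ^ 2 / 2 + (⟪ξ, x⟫ : ℂ) * Complex.I)

/-- The character `x ↦ exp (i ⟨ξ, x⟩)`. -/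
noncomputable def planeWave {d : ℕ} (ξ x : EucSpace d) : ℂ :=
  Complex.exp ((⟪ξ, x⟫ : ℂ) * Complex.I)

theorem gaussDensity_mul_planeWave {d : ℕ} (ξ x : EucSpace d) :
    (gaussDensity d 1 x : ℂ) * planeWave ξ x
      = ((2 * Real.pi) ^ (-((d : ℝ) / 2)) : ℝ) * gaussWave ξ x := by
  rw [gaussDensity, planeWave, gaussWave, Complex.exp_add]
  push_cast
  simp only [mul_one]
  rw [show -((‖x‖ : ℂ) ^ 2 / 2) = -(‖x‖ : ℂ) ^ 2 / 2 by ring]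
  ring

theorem norm_gaussWave {d : ℕ} (ξ x : EucSpace d) :
    ‖gaussWave ξ x‖ = Real.exp (-(1 / 2) * ‖x‖ ^ 2) := by
  rw [gaussWave, Complex.norm_exp]
  congr 1
  simp only [Complex.add_re, Complex.mul_re, Complex.ofReal_re, Complex.I_re, Complex.ofReal_im,
    Complex.I_im]
  rw [show -(‖x‖ : ℂ) ^ 2 / 2 = ((-‖x‖ ^ 2 / 2 : ℝ) : ℂ) by push_cast; ring, Complex.ofReal_re]
  ring

@[simp] theorem norm_planeWave {d : ℕ} (ξ x : EucSpace d) : ‖planeWave ξ x‖ = 1 := by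
  rw [planeWave, Complex.norm_exp_ofReal_mul_I]

theorem continuous_gaussWave {d : ℕ} (ξ : EucSpace d) : Continuous (gaussWave ξ) := by
  unfold gaussWave; fun_prop

theorem continuous_planeWave {d : ℕ} (ξ : EucSpace d) : Continuous (planeWave ξ) := by
  unfold planeWave; fun_prop

theorem conj_planeWave {d : ℕ} (ξ x : EucSpace d) :
    (starRingEnd ℂ) (planeWave ξ x) = planeWave (-ξ) x := by
  rw [planeWave, planeWave, ← Complex.exp_conj]
  simp

theorem planeWave_add {d : ℕ} (ξ η x : EucSpace d) :
    planeWave (ξ + η) x = planeWave ξ x * planeWave η x := by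
  rw [planeWave, planeWave, planeWave, ← Complex.exp_add, inner_add_left]
  push_cast
  ring_nf

theorem contDiff_planeWave {d : ℕ} (ξ : EucSpace d) (n : WithTop ℕ∞) :
    ContDiff ℝ n (planeWave ξ) := by
  have h : ContDiff ℝ n fun x : EucSpace d => (⟪ξ, x⟫ : ℂ) :=
    Complex.ofRealCLM.contDiff.comp (contDiff_const.inner ℝ contDiff_id)
  exact (h.mul contDiff_const).cexp

theorem hasFDerivAt_gaussWave {d : ℕ} (ξ x : EucSpace d) :
    HasFDerivAt (gaussWave ξ) (gaussWave ξ x •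
      (-(Complex.ofRealCLM.comp (innerSL ℝ x)) +
        Complex.I • (Complex.ofRealCLM.comp (innerSL ℝ ξ)))) x := by
  have h1 : HasFDerivAt (fun y : EucSpace d => ‖y‖ ^ 2) (2 • (innerSL ℝ x)) x :=
    (hasStrictFDerivAt_norm_sq x).hasFDerivAt
  have h2 := (Complex.ofRealCLM.hasFDerivAt (x := ‖x‖ ^ 2)).comp x h1
  have h3 := (Complex.ofRealCLM.comp (innerSL ℝ ξ)).hasFDerivAt (x := x)
  have h4 := ((h2.const_mul (-1 / 2 : ℂ)).add (h3.const_mul Complex.I)).cexp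
  have h5 : HasFDerivAt (gaussWave ξ) _ x := h4.congr_of_eventuallyEq
    (Eventually.of_forall fun y => by
      simp only [gaussWave, Function.comp_apply, Complex.ofRealCLM_apply, Pi.add_apply,
        ContinuousLinearMap.comp_apply, innerSL_apply_apply]
      push_cast
      ring_nf)
  refine h5.congr_fderiv ?_
  ext v
  simp only [gaussWave, Function.comp_apply, Complex.ofRealCLM_apply, Pi.add_apply,
    ContinuousLinearMap.comp_apply, innerSL_apply_apply, smul_apply, add_apply, neg_apply,
    smul_eq_mul, nsmul_eq_mul]
  push_cast
  ring_nf

theorem fderiv_gaussWave {d : ℕ} (ξ x v : EucSpace d) :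
    fderiv ℝ (gaussWave ξ) x v = gaussWave ξ x * (-(⟪x, v⟫ : ℂ) + (⟪ξ, v⟫ : ℂ) * Complex.I) := by
  rw [(hasFDerivAt_gaussWave ξ x).fderiv]
  simp
  ring

theorem hasFDerivAt_planeWave {d : ℕ} (ξ x : EucSpace d) :
    HasFDerivAt (planeWave ξ) (planeWave ξ x •
      (Complex.I • (Complex.ofRealCLM.comp (innerSL ℝ ξ)))) x := by
  have h3 := (Complex.ofRealCLM.comp (innerSL ℝ ξ)).hasFDerivAt (x := x)
  have h4 := (h3.const_mul Complex.I).cexp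
  have h5 : HasFDerivAt (planeWave ξ) _ x := h4.congr_of_eventuallyEq
    (Eventually.of_forall fun y => by simp [planeWave, mul_comm])
  refine h5.congr_fderiv ?_
  simp [planeWave, mul_comm]

theorem one_add_sq_le_exp (s : ℝ) : (1 + s) ^ 2 ≤ 8 * Real.exp (1 / 4 * s ^ 2) := by
  have := Real.add_one_le_exp (1 / 4 * s ^ 2)
  nlinarith [sq_nonneg (s - 1)]

theorem integrable_exp_neg_mul_sq_norm {d : ℕ} {b : ℝ} (hb : 0 < b) :
    Integrable fun x : EucSpace d => Real.exp (-b * ‖x‖ ^ 2) := by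
  have h := (GaussianFourier.integrable_cexp_neg_mul_sq_norm_add (V := EucSpace d) (b := b)
    (by simpa using hb) 0 0).norm
  refine h.congr (Eventually.of_forall fun x => ?_)
  simp only [Complex.norm_exp]
  congr 1
  simp only [zero_mul, add_zero]
  rw [show -(b : ℂ) * (‖x‖ : ℂ) ^ 2 = ((-b * ‖x‖ ^ 2 : ℝ) : ℂ) by push_cast; ring,
    Complex.ofReal_re]

/-- Half of the Gaussian decay, exp(-|x|²/4), absorbs the quadratic growth; the other half is
integrable. -/
theorem integrable_poly_gaussWave {d : ℕ} (ξ : EucSpace d) {f : EucSpace d → ℂ} {C : ℝ}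
    (hf : AEStronglyMeasurable f volume) (hC : ∀ x, ‖f x‖ ≤ C * (1 + ‖x‖) ^ 2) :
    Integrable fun x => gaussWave ξ x * f x := by
  refine Integrable.mono' ((integrable_exp_neg_mul_sq_norm (d := d) (b := 1 / 4)
    (by norm_num)).const_mul (C * 8)) ((continuous_gaussWave ξ).aestronglyMeasurable.mul hf)
    (Eventually.of_forall fun x => ?_)
  have hC0 : 0 ≤ C := by
    have := (norm_nonneg _).trans (hC 0)
    simpa using this
  rw [norm_mul, norm_gaussWave]
  calc Real.exp (-(1 / 2) * ‖x‖ ^ 2) * ‖f x‖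
      ≤ Real.exp (-(1 / 2) * ‖x‖ ^ 2) * (C * (8 * Real.exp (1 / 4 * ‖x‖ ^ 2))) := by
        gcongr
        exact (hC x).trans (by gcongr; exact one_add_sq_le_exp _)
    _ = C * 8 * (Real.exp (-(1 / 2) * ‖x‖ ^ 2) * Real.exp (1 / 4 * ‖x‖ ^ 2)) := by ring
    _ = _ := by rw [← Real.exp_add]; ring_nf

theorem integrable_gauss_of_poly {d : ℕ} {f : EucSpace d → ℂ} {C : ℝ}
    (hf : AEStronglyMeasurable f volume) (hC : ∀ x, ‖f x‖ ≤ C * (1 + ‖x‖) ^ 2) :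
    Integrable f (gaussMeasure d 1) := by
  rw [integrable_gaussMeasure_iff one_pos]
  have h := (integrable_poly_gaussWave 0 hf hC).const_mul
    (((2 * Real.pi) ^ (-((d : ℝ) / 2)) : ℝ) : ℂ)
  refine h.congr (Eventually.of_forall fun x => ?_)
  have h0 := gaussDensity_mul_planeWave 0 x
  simp only [← mul_assoc, ← h0]
  simp [planeWave]

instance isFiniteMeasure_gaussMeasure_one (d : ℕ) : IsFiniteMeasure (gaussMeasure d 1) := by
  have h := integrable_gauss_of_poly (d := d) (f := fun _ => (1 : ℂ)) (C := 1)
    aestronglyMeasurable_const (fun x => by rw [norm_one]; nlinarith [norm_nonneg x])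
  exact ((integrable_const_iff_isFiniteMeasure one_ne_zero).1 h)

theorem memLp_two_of_linear_growth {d : ℕ} {f : EucSpace d → ℂ} {C : ℝ}
    (hf : AEStronglyMeasurable f volume) (hC : ∀ x, ‖f x‖ ≤ C * (1 + ‖x‖)) :
    MemLp f 2 (gaussMeasure d 1) := by
  have hm : AEStronglyMeasurable f (gaussMeasure d 1) :=
    hf.mono_ac (gaussMeasure_absolutelyContinuous d 1)
  rw [memLp_two_iff_integrable_sq_norm hm]
  have h : Integrable (fun x => ((‖f x‖ ^ 2 : ℝ) : ℂ)) (gaussMeasure d 1) := by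
    refine integrable_gauss_of_poly (C := C ^ 2) ?_ fun x => ?_
    · exact Complex.continuous_ofReal.comp_aestronglyMeasurable (hf.norm.pow 2)
    · rw [Complex.norm_real, norm_pow, norm_norm, ← mul_pow]
      have := hC x
      gcongr
  exact h.re

/-- `∫ exp (i ⟨ξ, x⟩) dγ(x) = exp (-‖ξ‖² / 2)`. -/
theorem integral_planeWave {d : ℕ} (ξ : EucSpace d) :
    ∫ x, planeWave ξ x ∂(gaussMeasure d 1) = (Real.exp (-‖ξ‖ ^ 2 / 2) : ℝ) := by
  rw [integral_gaussMeasure one_pos]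
  simp_rw [gaussDensity_mul_planeWave]
  rw [integral_const_mul]
  have h := GaussianFourier.integral_cexp_neg_mul_sq_norm_add (V := EucSpace d) (b := (1 / 2 : ℂ))
    (by norm_num) Complex.I ξ
  have h2 : ∀ x : EucSpace d, gaussWave ξ x
      = Complex.exp (-(1 / 2 : ℂ) * (‖x‖ : ℂ) ^ 2 + Complex.I * (⟪ξ, x⟫ : ℂ)) := fun x => by
    rw [gaussWave]; congr 1; ring
  simp_rw [h2]
  rw [h]
  have hpi : (0 : ℝ) < 2 * Real.pi := by positivity
  have h3 : ((Real.pi : ℂ) / (1 / 2)) ^ ((Module.finrank ℝ (EucSpace d) : ℂ) / 2)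
      = (((2 * Real.pi) ^ ((d : ℝ) / 2) : ℝ) : ℂ) := by
    rw [Complex.ofReal_cpow hpi.le]
    simp
    congr 1
    ring
  rw [h3, ← mul_assoc, ← Complex.ofReal_mul, ← Real.rpow_add hpi]
  simp
  congr 1
  ring

/-! ### Characters as vectors of L²(γ): inner products and density. -/

/-- `exp (i ⟨ξ, ·⟩)` as an element of `L²(γ)`. -/
noncomputable def waveL2 {d : ℕ} (ξ : EucSpace d) : GaussL2 d :=
  (memLp_two_of_linear_growth (C := 1) (continuous_planeWave ξ).aestronglyMeasurable
    (fun x => by simp)).toLp (planeWave ξ)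

theorem coeFn_waveL2 {d : ℕ} (ξ : EucSpace d) : waveL2 ξ =ᵐ[gaussMeasure d 1] planeWave ξ :=
  MemLp.coeFn_toLp _

/-- The function `(-Δ + x · ∇) exp (i ⟨ξ, ·⟩)`. -/
noncomputable def ouWave {d : ℕ} (ξ x : EucSpace d) : ℂ :=
  ((‖ξ‖ : ℂ) ^ 2 + (⟪ξ, x⟫ : ℂ) * Complex.I) * planeWave ξ x

theorem norm_ouWave_le {d : ℕ} (ξ x : EucSpace d) :
    ‖ouWave ξ x‖ ≤ (‖ξ‖ ^ 2 + ‖ξ‖) * (1 + ‖x‖) := by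
  rw [ouWave, norm_mul, norm_planeWave, mul_one]
  refine (norm_add_le _ _).trans ?_
  rw [norm_mul, Complex.norm_I, Complex.norm_real, norm_pow, Complex.norm_real, norm_norm]
  have := norm_inner_le_norm (𝕜 := ℝ) ξ x
  nlinarith [norm_nonneg ξ, norm_nonneg x, mul_nonneg (sq_nonneg ‖ξ‖) (norm_nonneg x)]

theorem continuous_ouWave {d : ℕ} (ξ : EucSpace d) : Continuous (ouWave ξ) := by
  unfold ouWave
  have := continuous_planeWave ξ
  fun_prop

/-- `(-Δ + x · ∇) exp (i ⟨ξ, ·⟩)` as an element of `L²(γ)`. -/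
noncomputable def ouWaveL2 {d : ℕ} (ξ : EucSpace d) : GaussL2 d :=
  (memLp_two_of_linear_growth (continuous_ouWave ξ).aestronglyMeasurable
    (norm_ouWave_le ξ)).toLp (ouWave ξ)

theorem coeFn_ouWaveL2 {d : ℕ} (ξ : EucSpace d) : ouWaveL2 ξ =ᵐ[gaussMeasure d 1] ouWave ξ :=
  MemLp.coeFn_toLp _

theorem inner_waveL2_left {d : ℕ} (ξ : EucSpace d) (f : GaussL2 d) :
    inner ℂ (waveL2 ξ) f = ∫ x, planeWave (-ξ) x * f x ∂(gaussMeasure d 1) := by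
  rw [L2.inner_def]
  refine integral_congr_ae ?_
  filter_upwards [coeFn_waveL2 ξ] with x hx
  rw [hx, RCLike.inner_apply, conj_planeWave, mul_comm]

theorem inner_waveL2_waveL2 {d : ℕ} (ξ η : EucSpace d) :
    inner ℂ (waveL2 η) (waveL2 ξ) = (Real.exp (-‖ξ - η‖ ^ 2 / 2) : ℝ) := by
  rw [inner_waveL2_left, ← integral_planeWave]
  refine integral_congr_ae ?_
  filter_upwards [coeFn_waveL2 ξ] with x hx
  rw [hx, sub_eq_neg_add, planeWave_add]

theorem integral_inner_mul_planeWave {d : ℕ} (ξ ζ : EucSpace d) :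
    ∫ x, (⟪ξ, x⟫ : ℂ) * planeWave ζ x ∂(gaussMeasure d 1)
      = (⟪ξ, ζ⟫ : ℂ) * Complex.I * (Real.exp (-‖ζ‖ ^ 2 / 2) : ℝ) := by
  have hI : ∀ (f : EucSpace d → ℂ) (C : ℝ), Continuous f → (∀ x, ‖f x‖ ≤ C * (1 + ‖x‖) ^ 2) →
      Integrable fun x => gaussWave ζ x * f x := fun f C hf hC =>
    integrable_poly_gaussWave ζ hf.aestronglyMeasurable hC
  have h1 : Integrable fun x => gaussWave ζ x * 1 :=
    hI _ 1 continuous_const fun x => by rw [norm_one]; nlinarith [norm_nonneg x]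
  have h2 : Integrable fun x : EucSpace d => gaussWave ζ x * (⟪ξ, x⟫ : ℂ) :=
    hI _ ‖ξ‖ (by fun_prop) fun x => by
      rw [Complex.norm_real]
      have := norm_inner_le_norm (𝕜 := ℝ) ξ x
      nlinarith [norm_nonneg ξ, norm_nonneg x, mul_nonneg (norm_nonneg ξ) (norm_nonneg x),
        mul_nonneg (norm_nonneg ξ) (sq_nonneg ‖x‖)]
  have hder : ∀ x, (1 : ℂ) * fderiv ℝ (gaussWave ζ) x ξ
      = (⟪ξ, ζ⟫ : ℂ) * Complex.I * (gaussWave ζ x * 1) - gaussWave ζ x * (⟪ξ, x⟫ : ℂ) := fun x => by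
    rw [fderiv_gaussWave, real_inner_comm ξ x, real_inner_comm ζ ξ]
    ring
  -- Integration by parts against the constant 1: the derivative of `gaussWave ζ` in direction ξ has
  -- integral zero.
  have hzero := integral_mul_fderiv_eq_neg_fderiv_mul_of_integrable (𝕜 := ℂ)
    (μ := (volume : Measure (EucSpace d))) (f := fun _ => (1 : ℂ)) (g := gaussWave ζ) (v := ξ)
    (by simp) (by simp_rw [hder]; exact (h1.const_mul _).sub h2) (by simpa using h1)
    (fun x _ => differentiableAt_const _)
    (fun x _ => (hasFDerivAt_gaussWave ζ x).differentiableAt)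
  simp_rw [hder] at hzero
  rw [integral_sub (h1.const_mul _) h2, integral_const_mul] at hzero
  simp only [fderiv_fun_const, Pi.zero_apply, zero_apply, zero_mul,
    integral_zero, neg_zero, sub_eq_zero] at hzero
  rw [← integral_planeWave, integral_gaussMeasure one_pos, integral_gaussMeasure one_pos]
  have e1 : ∀ x : EucSpace d, (gaussDensity d 1 x : ℂ) * ((⟪ξ, x⟫ : ℂ) * planeWave ζ x)
      = ((2 * Real.pi) ^ (-((d : ℝ) / 2)) : ℝ) * (gaussWave ζ x * (⟪ξ, x⟫ : ℂ)) := fun x => by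
    linear_combination (⟪ξ, x⟫ : ℂ) * gaussDensity_mul_planeWave ζ x
  simp_rw [e1, gaussDensity_mul_planeWave]
  rw [integral_const_mul, integral_const_mul, ← hzero]
  simp only [mul_one]
  ring

theorem inner_waveL2_ouWaveL2 {d : ℕ} (ξ η : EucSpace d) :
    inner ℂ (waveL2 η) (ouWaveL2 ξ) = (⟪ξ, η⟫ * Real.exp (-‖ξ - η‖ ^ 2 / 2) : ℝ) := by
  rw [inner_waveL2_left]
  have h : ∀ᵐ x ∂(gaussMeasure d 1), planeWave (-η) x * ouWaveL2 ξ x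
      = (‖ξ‖ : ℂ) ^ 2 * planeWave (ξ - η) x
        + Complex.I * ((⟪ξ, x⟫ : ℂ) * planeWave (ξ - η) x) := by
    filter_upwards [coeFn_ouWaveL2 ξ] with x hx
    rw [hx, ouWave, sub_eq_neg_add, planeWave_add]
    ring
  rw [integral_congr_ae h, integral_add, integral_const_mul, integral_const_mul,
    integral_planeWave, integral_inner_mul_planeWave]
  · have : (Complex.I * Complex.I) = -1 := Complex.I_mul_I
    rw [inner_sub_right, real_inner_self_eq_norm_sq]
    push_cast
    linear_combination ((‖ξ‖ : ℂ) ^ 2 - (⟪ξ, η⟫ : ℂ)) * Complex.exp (-‖ξ - η‖ ^ 2 / 2) * this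
  · refine (integrable_gauss_of_poly (C := 1) (continuous_planeWave _).aestronglyMeasurable
      fun x => ?_).const_mul _
    rw [norm_planeWave]
    nlinarith [norm_nonneg x]
  · refine (integrable_gauss_of_poly (C := ‖ξ‖) (Continuous.aestronglyMeasurable ?_)
      fun x => ?_).const_mul _
    · have := continuous_planeWave (ξ - η)
      fun_prop
    · rw [norm_mul, norm_planeWave, mul_one, Complex.norm_real]
      have := norm_inner_le_norm (𝕜 := ℝ) ξ x
      nlinarith [norm_nonneg ξ, norm_nonneg x, mul_nonneg (norm_nonneg ξ) (norm_nonneg x),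
        mul_nonneg (norm_nonneg ξ) (sq_nonneg ‖x‖)]

/-- The characters span a dense subspace of `L²(γ)`. -/
theorem span_waveL2_topologicalClosure (d : ℕ) :
    (Submodule.span ℂ (range (waveL2 : EucSpace d → GaussL2 d))).topologicalClosure = ⊤ := by
  rw [Submodule.topologicalClosure_eq_top_iff, Submodule.eq_bot_iff]
  intro f hf
  have h0 : ∀ ξ : EucSpace d, inner ℂ (waveL2 ξ) f = 0 := fun ξ =>
    (Submodule.mem_orthogonal _ _).1 hf _ (Submodule.subset_span ⟨ξ, rfl⟩)
  set F : EucSpace d → ℂ := fun x => (gaussDensity d 1 x : ℂ) * f x with hF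
  have hFi : Integrable F :=
    (integrable_gaussMeasure_iff one_pos _).1 ((Lp.memLp f).integrable (by norm_num))
  -- Orthogonality to all characters says that the density times f has vanishing Fourier transform;
  -- the factor 2π is the normalization of `Real.fourierChar`.
  have hfour : ∀ w : EucSpace d, VectorFourier.fourierIntegral Real.fourierChar volume
      (innerₗ (EucSpace d)) F w = 0 := by
    intro w
    have h1 := h0 ((2 * Real.pi) • w)
    rw [inner_waveL2_left, integral_gaussMeasure one_pos] at h1
    rw [VectorFourier.fourierIntegral, ← h1]
    refine integral_congr_ae (Eventually.of_forall fun x => ?_)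
    simp only [hF, Circle.smul_def, Real.fourierChar_apply, smul_eq_mul, planeWave]
    rw [inner_neg_left, real_inner_smul_left, innerₗ_apply_apply, real_inner_comm w x]
    push_cast
    ring_nf
  have hae : ∀ᵐ x, F x = 0 := by
    -- Injectivity of the Fourier transform on L¹ by duality: a test function is the transform of a
    -- Schwartz function ψ, so its integral against F equals that of ψ against the transform of F,
    -- which is 0.
    refine ae_eq_zero_of_integral_contDiff_smul_eq_zero hFi.locallyIntegrable fun g hg hgc => ?_
    have hgc' : HasCompactSupport fun x => (g x : ℂ) := hgc.comp_left Complex.ofReal_zero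
    let φ : SchwartzMap (EucSpace d) ℂ := hgc'.toSchwartzMap (Complex.ofRealCLM.contDiff.comp hg)
    let ψ : SchwartzMap (EucSpace d) ℂ := FourierTransform.fourierInv φ
    have h1 := VectorFourier.integral_fourierIntegral_smul_eq_flip (L := innerₗ (EucSpace d))
      (μ := volume) (ν := volume) (f := F) (g := ψ) (e := Real.fourierChar)
      Real.continuous_fourierChar
      (by simp only [innerₗ_apply_apply]; exact continuous_inner) hFi ψ.integrable
    simp only [hfour, zero_smul, integral_zero, flip_innerₗ] at h1
    rw [h1]
    refine integral_congr_ae (Eventually.of_forall fun x => ?_)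
    have h2 : (FourierTransform.fourier ψ : SchwartzMap (EucSpace d) ℂ) = φ :=
      FourierTransform.fourier_fourierInv_eq φ
    have h3 : VectorFourier.fourierIntegral Real.fourierChar volume
      (innerₗ (EucSpace d)) ψ x = φ x := by
      rw [← h2]; rfl
    simp only [h3]
    rw [Complex.real_smul, smul_eq_mul, mul_comm]
    rfl
  rw [Lp.eq_zero_iff_ae_eq_zero]
  refine (ae_gaussMeasure_iff one_pos).2 ?_
  filter_upwards [hae] with x hx
  have : (gaussDensity d 1 x : ℂ) ≠ 0 := by
    exact_mod_cast (gaussDensity_pos one_pos x).ne'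
  simpa [hF, this] using hx

/-! ### A Young type inequality for integral kernels -/

/-- Young's inequality with target exponent 2 for a kernel that need not be a convolution. Split kh
= (k^q h^p)^(1/2) · (k^q)^(1/q - 1/2) · (h^p)^(1/p - 1/2). The three outer exponents sum to 1, so
Hölder applies in y; after squaring, Tonelli leaves the column integral of k^q. Separate bounds A
and B are kept because the dilation makes row and column integrals differ. -/
theorem lintegral_kernel_sq_le {X Y : Type*} [MeasurableSpace X] [MeasurableSpace Y]
    {μ : Measure X} {ν : Measure Y} [SFinite μ] [SFinite ν] {k : X → Y → ℝ≥0∞}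
    (hk : Measurable (Function.uncurry k)) {h : Y → ℝ≥0∞} (hh : AEMeasurable h ν) {p q : ℝ}
    (hp : 1 ≤ p) (hp2 : p ≤ 2) (hq : 1 ≤ q) (hq2 : q ≤ 2) (hpq : 1 / p + 1 / q = 3 / 2)
    {A B : ℝ≥0∞} (hA : ∀ x, ∫⁻ y, k x y ^ q ∂ν ≤ A) (hB : ∀ y, ∫⁻ x, k x y ^ q ∂μ ≤ B) :
    ∫⁻ x, (∫⁻ y, k x y * h y ∂ν) ^ (2 : ℝ) ∂μ
      ≤ (A ^ (1 / q - 1 / 2) * B ^ (1 / 2 : ℝ) * (∫⁻ y, h y ^ p ∂ν) ^ (1 / p)) ^ (2 : ℝ) := by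
  have hp0 : 0 < p := by linarith
  have hq0 : 0 < q := by linarith
  have hs : 0 ≤ 1 / p - 1 / 2 := by
    have := one_div_le_one_div_of_le hp0 hp2
    linarith
  have hu : 0 ≤ 1 / q - 1 / 2 := by
    have := one_div_le_one_div_of_le hq0 hq2
    linarith
  have hkx : ∀ x, Measurable (k x) := fun x => hk.of_uncurry_left
  set P := ∫⁻ y, h y ^ p ∂ν with hP
  have hpt : ∀ x y, k x y * h y
      = (k x y ^ q * h y ^ p) ^ (1 / 2 : ℝ) * (k x y ^ q) ^ (1 / q - 1 / 2)
        * (h y ^ p) ^ (1 / p - 1 / 2) := fun x y => by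
    have e1 : k x y ^ (q * (1 / 2)) * k x y ^ (q * (1 / q - 1 / 2)) = k x y := by
      rw [← ENNReal.rpow_add_of_nonneg _ _ (by positivity) (by positivity),
        ← mul_add, add_sub_cancel, mul_one_div_cancel hq0.ne', ENNReal.rpow_one]
    have e2 : h y ^ (p * (1 / 2)) * h y ^ (p * (1 / p - 1 / 2)) = h y := by
      rw [← ENNReal.rpow_add_of_nonneg _ _ (by positivity) (by positivity),
        ← mul_add, add_sub_cancel, mul_one_div_cancel hp0.ne', ENNReal.rpow_one]
    rw [ENNReal.mul_rpow_of_nonneg _ _ (by norm_num), ← ENNReal.rpow_mul, ← ENNReal.rpow_mul,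
      ← ENNReal.rpow_mul, ← ENNReal.rpow_mul]
    conv_lhs => rw [← e1, ← e2]
    ring
  have hhol : ∀ x, ∫⁻ y, k x y * h y ∂ν
      ≤ (∫⁻ y, k x y ^ q * h y ^ p ∂ν) ^ (1 / 2 : ℝ) * A ^ (1 / q - 1 / 2)
        * P ^ (1 / p - 1 / 2) := fun x => by
    have h3 := ENNReal.lintegral_prod_norm_pow_le (μ := ν) (Finset.univ : Finset (Fin 3))
      (f := ![fun y => k x y ^ q * h y ^ p, fun y => k x y ^ q, fun y => h y ^ p])
      (p := ![1 / 2, 1 / q - 1 / 2, 1 / p - 1 / 2])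
      (by
        intro i _
        fin_cases i
        · exact ((hkx x).pow_const q).aemeasurable.mul (hh.pow_const p)
        · exact ((hkx x).pow_const q).aemeasurable
        · exact hh.pow_const p)
      (by simp only [Fin.sum_univ_three, Matrix.cons_val]; linarith)
      (by
        intro i _
        fin_cases i
        · norm_num
        · exact hu
        · exact hs)
    simp only [Fin.prod_univ_three, Matrix.cons_val] at h3
    simp_rw [← hpt] at h3
    refine h3.trans ?_
    gcongr
    exact hA x
  have hkh : AEMeasurable (Function.uncurry fun x y => k x y ^ q * h y ^ p) (μ.prod ν) :=
    (hk.pow_const q).aemeasurable.mul ((hh.comp_snd).pow_const p)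
  calc ∫⁻ x, (∫⁻ y, k x y * h y ∂ν) ^ (2 : ℝ) ∂μ
      ≤ ∫⁻ x, (∫⁻ y, k x y ^ q * h y ^ p ∂ν)
          * (A ^ (1 / q - 1 / 2) * P ^ (1 / p - 1 / 2)) ^ (2 : ℝ) ∂μ := by
        refine lintegral_mono fun x => ?_
        refine (ENNReal.rpow_le_rpow (hhol x) (by norm_num)).trans (le_of_eq ?_)
        rw [mul_assoc, ENNReal.mul_rpow_of_nonneg _ _ (by norm_num), ← ENNReal.rpow_mul]
        norm_num
    _ = (∫⁻ x, ∫⁻ y, k x y ^ q * h y ^ p ∂ν ∂μ)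
          * (A ^ (1 / q - 1 / 2) * P ^ (1 / p - 1 / 2)) ^ (2 : ℝ) :=
        lintegral_mul_const'' _ hkh.lintegral_prod_right'
    _ ≤ (B * P) * (A ^ (1 / q - 1 / 2) * P ^ (1 / p - 1 / 2)) ^ (2 : ℝ) := by
        gcongr
        rw [lintegral_lintegral_swap hkh]
        have : ∀ y, ∫⁻ x, k x y ^ q * h y ^ p ∂μ ≤ B * h y ^ p := fun y => by
          rw [lintegral_mul_const _ ((hk.of_uncurry_right).pow_const q)]
          gcongr
          exact hB y
        refine (lintegral_mono this).trans (le_of_eq ?_)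
        rw [lintegral_const_mul'' _ (hh.pow_const p)]
    _ = _ := by
        have e : P ^ (1 / p) = P ^ (1 / 2 : ℝ) * P ^ (1 / p - 1 / 2) := by
          rw [← ENNReal.rpow_add_of_nonneg _ _ (by norm_num) hs, add_sub_cancel]
        rw [e]
        simp only [ENNReal.mul_rpow_of_nonneg _ _ (zero_le_two (α := ℝ))]
        rw [← ENNReal.rpow_mul B, ← ENNReal.rpow_mul P (1 / 2)]
        norm_num
        ring

/-! ### The Mehler kernel -/

/-- The Mehler kernel with respect to Lebesgue measure. -/
noncomputable def mehlerKernel {d : ℕ} (t : ℝ) (x y : EucSpace d) : ℝ :=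
  (2 * Real.pi * (1 - Real.exp (-2 * t))) ^ (-((d : ℝ) / 2)) *
    Real.exp (-(‖y - Real.exp (-t) • x‖ ^ 2 / (2 * (1 - Real.exp (-2 * t)))))

/-- The Mehler formula. -/
noncomputable def mehlerIntegral {d : ℕ} (t : ℝ) (f : EucSpace d → ℂ) (x : EucSpace d) : ℂ :=
  ∫ y, (mehlerKernel t x y : ℂ) * f y

theorem one_sub_exp_pos {t : ℝ} (ht : 0 < t) : 0 < 1 - Real.exp (-2 * t) := by
  have : Real.exp (-2 * t) < 1 := Real.exp_lt_one_iff.2 (by linarith)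
  linarith

theorem mehlerKernel_pos {d : ℕ} {t : ℝ} (ht : 0 < t) (x y : EucSpace d) :
    0 < mehlerKernel t x y := by
  have := one_sub_exp_pos ht
  unfold mehlerKernel; positivity

theorem continuous_uncurry_mehlerKernel (d : ℕ) (t : ℝ) :
    Continuous fun z : EucSpace d × EucSpace d => mehlerKernel t z.1 z.2 := by
  unfold mehlerKernel; fun_prop

theorem lintegral_exp_neg_mul_sq_norm {d : ℕ} {b : ℝ} (hb : 0 < b) (v : EucSpace d) :
    ∫⁻ x : EucSpace d, ENNReal.ofReal (Real.exp (-b * ‖x - v‖ ^ 2))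
      = ENNReal.ofReal ((Real.pi / b) ^ ((d : ℝ) / 2)) := by
  rw [lintegral_sub_right_eq_self (fun x : EucSpace d =>
    ENNReal.ofReal (Real.exp (-b * ‖x‖ ^ 2))) v,
    ← ofReal_integral_eq_lintegral_ofReal (integrable_exp_neg_mul_sq_norm hb)
      (Eventually.of_forall fun x => (Real.exp_pos _).le),
    GaussianFourier.integral_rexp_neg_mul_sq_norm hb]
  simp

/-- Conjugated by the square root of the output density and the `p`-th root of the input density,
the Mehler kernel becomes a convolution kernel followed by a dilation. -/
theorem mehlerKernel_weighted {d : ℕ} {t p : ℝ} (ht : 0 < t) (hp : 0 < p) (x y : EucSpace d) :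
    gaussDensity d 1 x ^ (1 / 2 : ℝ) * mehlerKernel t x y
        * gaussDensity d ((1 + Real.exp (-2 * t)) / p) y ^ (-(1 / p))
      = ((2 * Real.pi) ^ (-((d : ℝ) / 4))
          * (2 * Real.pi * (1 - Real.exp (-2 * t))) ^ (-((d : ℝ) / 2))
          * (2 * Real.pi * ((1 + Real.exp (-2 * t)) / p)) ^ ((d : ℝ) / 2 * (1 / p)))
        * Real.exp (-((1 + Real.exp (-2 * t)) / (4 * (1 - Real.exp (-2 * t))))
          * ‖x - (2 * Real.exp (-t) / (1 + Real.exp (-2 * t))) • y‖ ^ 2) := by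
  have h1 := one_sub_exp_pos ht
  have hRr : Real.exp (-2 * t) = Real.exp (-t) ^ 2 := by
    rw [← Real.exp_nat_mul]; ring_nf
  have hpi : 0 < Real.pi := Real.pi_pos
  have hR : 0 < Real.exp (-2 * t) := Real.exp_pos _
  have hg : ∀ (τ : ℝ) (z : EucSpace d) (e : ℝ), 0 < τ → gaussDensity d τ z ^ e
      = (2 * Real.pi * τ) ^ (-((d : ℝ) / 2) * e)
        * Real.exp (-(‖z‖ ^ 2 / (2 * τ)) * e) := fun τ z e hτ => by
    rw [gaussDensity, Real.mul_rpow (by positivity) (by positivity),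
      ← Real.rpow_mul (by positivity), ← Real.exp_mul]
  rw [hg 1 x _ one_pos, hg _ y _ (by positivity), mehlerKernel]
  have e : Real.exp (-((1 + Real.exp (-2 * t)) / (4 * (1 - Real.exp (-2 * t))))
          * ‖x - (2 * Real.exp (-t) / (1 + Real.exp (-2 * t))) • y‖ ^ 2)
      = Real.exp (-(‖x‖ ^ 2 / (2 * 1)) * (1 / 2))
        * Real.exp (-(‖y - Real.exp (-t) • x‖ ^ 2 / (2 * (1 - Real.exp (-2 * t)))))
        * Real.exp (-(‖y‖ ^ 2 / (2 * ((1 + Real.exp (-2 * t)) / p))) * (-(1 / p))) := by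
    rw [← Real.exp_add, ← Real.exp_add]
    congr 1
    rw [norm_sub_sq_real, norm_sub_sq_real, norm_smul, norm_smul, real_inner_smul_right,
      real_inner_smul_right, mul_pow, mul_pow, Real.norm_eq_abs, Real.norm_eq_abs, sq_abs, sq_abs,
      real_inner_comm x y, hRr]
    rw [hRr] at h1
    generalize Real.exp (-t) = r at *
    have h1' : 1 - r ^ 2 ≠ 0 := h1.ne'
    have h2' : 1 + r ^ 2 ≠ 0 := by positivity
    field_simp
    ring
  rw [e]
  have e1 : -((d : ℝ) / 2) * (1 / 2) = -((d : ℝ) / 4) := by ring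
  have e2 : -((d : ℝ) / 2) * (-(1 / p)) = (d : ℝ) / 2 * (1 / p) := by ring
  rw [e1, e2, mul_one (2 * Real.pi)]
  ring

/-- A bound for the norm of `exp (-tL)` from `L^p` to `L^2`, with `s = 1 / p`. -/
noncomputable def ouBound (d : ℕ) (s t : ℝ) : ℝ :=
  (4 * Real.pi) ^ (d : ℝ) * Real.exp (t * (d * (1 - s)))
    * (1 - Real.exp (-2 * t)) ^ (-((d : ℝ) / 2 * (s - 1 / 2)))

theorem ouBound_pos (d : ℕ) (s : ℝ) {t : ℝ} (ht : 0 < t) : 0 < ouBound d s t := by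
  have := one_sub_exp_pos ht
  unfold ouBound; positivity

/-- The left side is A^(1/q - 1/2) B^(1/2) from Young's inequality, with the row and column
integrals of the weighted kernel evaluated. Each factor is estimated separately; only the power of 1
- e^{-2t} has to be exact. -/
theorem weighted_constant_le {d : ℕ} {t p q : ℝ} (ht : 0 < t) (hp : 1 ≤ p) (hq : 1 ≤ q)
    (hq2 : q ≤ 2) (hpq : 1 / p + 1 / q = 3 / 2) :
    ((2 * Real.pi) ^ (-((d : ℝ) / 4))
        * (2 * Real.pi * (1 - Real.exp (-2 * t))) ^ (-((d : ℝ) / 2))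
        * (2 * Real.pi * ((1 + Real.exp (-2 * t)) / p)) ^ ((d : ℝ) / 2 * (1 / p)))
      * (Real.pi / (q * ((1 + Real.exp (-2 * t)) / (4 * (1 - Real.exp (-2 * t))))))
          ^ ((d : ℝ) / 2 * (1 / q))
      * (2 * Real.exp (-t) / (1 + Real.exp (-2 * t))) ^ (-((d : ℝ) * (1 / q - 1 / 2)))
      ≤ ouBound d (1 / p) t := by
  have h1 := one_sub_exp_pos ht
  have hpi : 3 < Real.pi := Real.pi_gt_three
  have hR : 0 < Real.exp (-2 * t) := Real.exp_pos _
  have hR1 : Real.exp (-2 * t) < 1 := by linarith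
  have hp0 : 0 < p := by linarith
  have hq0 : 0 < q := by linarith
  have hs1 : 1 / p ≤ 1 := (div_le_one hp0).2 hp
  have hu1 : 1 / q ≤ 1 := (div_le_one hq0).2 hq
  have hs0 : 0 < 1 / p := by positivity
  have hu0 : 0 < 1 / q := by positivity
  have hu2 : 1 / 2 ≤ 1 / q := one_div_le_one_div_of_le hq0 hq2
  have hd : (0 : ℝ) ≤ d := Nat.cast_nonneg d
  have b1 : (2 * Real.pi) ^ (-((d : ℝ) / 4)) ≤ 1 :=
    Real.rpow_le_one_of_one_le_of_nonpos (by linarith) (by linarith)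
  have b2 : (2 * Real.pi * (1 - Real.exp (-2 * t))) ^ (-((d : ℝ) / 2))
      ≤ 1 * (1 - Real.exp (-2 * t)) ^ (-((d : ℝ) / 2)) := by
    rw [Real.mul_rpow (by positivity) h1.le]
    gcongr
    exact Real.rpow_le_one_of_one_le_of_nonpos (by linarith) (by linarith)
  have b3 : (2 * Real.pi * ((1 + Real.exp (-2 * t)) / p)) ^ ((d : ℝ) / 2 * (1 / p))
      ≤ (4 * Real.pi) ^ ((d : ℝ) / 2) := by
    have : (1 + Real.exp (-2 * t)) / p ≤ 2 := by
      rw [div_le_iff₀ hp0]; linarith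
    calc _ ≤ (4 * Real.pi) ^ ((d : ℝ) / 2 * (1 / p)) :=
          Real.rpow_le_rpow (by positivity) (by nlinarith) (by positivity)
      _ ≤ _ := Real.rpow_le_rpow_of_exponent_le (by linarith) (by nlinarith)
  have b4 : (Real.pi / (q * ((1 + Real.exp (-2 * t)) / (4 * (1 - Real.exp (-2 * t))))))
          ^ ((d : ℝ) / 2 * (1 / q))
      ≤ (4 * Real.pi) ^ ((d : ℝ) / 2) * (1 - Real.exp (-2 * t)) ^ ((d : ℝ) / 2 * (1 / q)) := by
    have h5 : Real.pi / (q * ((1 + Real.exp (-2 * t)) / (4 * (1 - Real.exp (-2 * t)))))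
        ≤ 4 * Real.pi * (1 - Real.exp (-2 * t)) := by
      rw [div_le_iff₀ (by positivity)]
      have : 4 * Real.pi * (1 - Real.exp (-2 * t)) *
          (q * ((1 + Real.exp (-2 * t)) / (4 * (1 - Real.exp (-2 * t)))))
          = Real.pi * (q * (1 + Real.exp (-2 * t))) := by
        have := h1.ne'
        generalize Real.exp (-2 * t) = R at *
        field_simp
      rw [this]
      nlinarith [mul_le_mul hq (by linarith : 1 ≤ 1 + Real.exp (-2 * t)) zero_le_one hq0.le]
    calc _ ≤ (4 * Real.pi * (1 - Real.exp (-2 * t))) ^ ((d : ℝ) / 2 * (1 / q)) :=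
          Real.rpow_le_rpow (by positivity) h5 (by positivity)
      _ = (4 * Real.pi) ^ ((d : ℝ) / 2 * (1 / q))
          * (1 - Real.exp (-2 * t)) ^ ((d : ℝ) / 2 * (1 / q)) :=
          Real.mul_rpow (by positivity) h1.le
      _ ≤ _ := by
          gcongr
          · linarith
          · nlinarith
  -- The dilation factor is at least e^{-t}, and 1/q - 1/2 = 1 - 1/p, so this loss disappears for p
  -- = 1.
  have b5 : (2 * Real.exp (-t) / (1 + Real.exp (-2 * t))) ^ (-((d : ℝ) * (1 / q - 1 / 2)))
      ≤ Real.exp (t * (d * (1 - 1 / p))) := by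
    have h6 : Real.exp (-t) ≤ 2 * Real.exp (-t) / (1 + Real.exp (-2 * t)) := by
      rw [le_div_iff₀ (by positivity)]
      nlinarith [Real.exp_pos (-t)]
    refine (Real.rpow_le_rpow_of_nonpos (Real.exp_pos _) h6 ?_).trans (le_of_eq ?_)
    · have : 0 ≤ (d : ℝ) * (1 / q - 1 / 2) := mul_nonneg hd (by linarith)
      linarith
    · rw [← Real.exp_mul]
      congr 1
      have : 1 - 1 / p = 1 / q - 1 / 2 := by linarith
      rw [this]; ring
  calc _ ≤ (1 * (1 * (1 - Real.exp (-2 * t)) ^ (-((d : ℝ) / 2))) * (4 * Real.pi) ^ ((d : ℝ) / 2))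
        * ((4 * Real.pi) ^ ((d : ℝ) / 2) * (1 - Real.exp (-2 * t)) ^ ((d : ℝ) / 2 * (1 / q)))
        * Real.exp (t * (d * (1 - 1 / p))) := by gcongr
    _ = ((4 * Real.pi) ^ ((d : ℝ) / 2) * (4 * Real.pi) ^ ((d : ℝ) / 2))
        * Real.exp (t * (d * (1 - 1 / p)))
        * ((1 - Real.exp (-2 * t)) ^ (-((d : ℝ) / 2))
          * (1 - Real.exp (-2 * t)) ^ ((d : ℝ) / 2 * (1 / q))) := by ring
    _ = _ := by
        rw [← Real.rpow_add (by positivity), ← Real.rpow_add h1, ouBound]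
        have e1 : (d : ℝ) / 2 + d / 2 = d := by ring
        have e2 : -((d : ℝ) / 2) + d / 2 * (1 / q) = -((d : ℝ) / 2 * (1 / p - 1 / 2)) := by
          have : 1 / q = 3 / 2 - 1 / p := by linarith
          rw [this]; ring
        rw [e1, e2]

theorem lintegral_mehlerKernel_sq_le {d : ℕ} {t p : ℝ} (ht : 0 < t) (hp : 1 ≤ p) (hp2 : p ≤ 2)
    {f : EucSpace d → ℝ≥0∞} (hf : AEMeasurable f volume) :
    ∫⁻ x, (∫⁻ y, ENNReal.ofReal (mehlerKernel t x y) * f y) ^ (2 : ℝ) ∂(gaussMeasure d 1)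
      ≤ (ENNReal.ofReal (ouBound d (1 / p) t)
        * (∫⁻ y, f y ^ p ∂(gaussMeasure d ((1 + Real.exp (-2 * t)) / p))) ^ (1 / p))
          ^ (2 : ℝ) := by
  have h1 := one_sub_exp_pos ht
  have hpi : 0 < Real.pi := Real.pi_pos
  have hR : 0 < Real.exp (-2 * t) := Real.exp_pos _
  have hp0 : 0 < p := by linarith
  have hs1 : 1 / p ≤ 1 := (div_le_one hp0).2 hp
  have hs2 : 1 / 2 ≤ 1 / p := one_div_le_one_div_of_le hp0 hp2
  -- The Young exponent: 1/q = 3/2 - 1/p lies in [1/2, 1] precisely because 1/p does.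
  obtain ⟨q, hq, hq2, hpq⟩ : ∃ q : ℝ, 1 ≤ q ∧ q ≤ 2 ∧ 1 / p + 1 / q = 3 / 2 := by
    have h3 : 0 < 3 / 2 - 1 / p := by linarith
    refine ⟨1 / (3 / 2 - 1 / p), ?_, ?_, ?_⟩
    · rw [le_div_iff₀ h3]; linarith
    · rw [div_le_iff₀ h3]; linarith
    · rw [one_div_one_div]; ring
  have hq0 : 0 < q := by linarith
  set α := (1 + Real.exp (-2 * t)) / p with hα
  have hα0 : 0 < α := by positivity
  have hweight := fun x y : EucSpace d => mehlerKernel_weighted ht hp0 x y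
  have hle := weighted_constant_le (d := d) ht hp hq hq2 hpq
  rw [← hα] at hweight hle
  set c := (2 * Real.pi) ^ (-((d : ℝ) / 4))
          * (2 * Real.pi * (1 - Real.exp (-2 * t))) ^ (-((d : ℝ) / 2))
          * (2 * Real.pi * α) ^ ((d : ℝ) / 2 * (1 / p)) with hc
  have hc0 : 0 < c := by positivity
  set b := (1 + Real.exp (-2 * t)) / (4 * (1 - Real.exp (-2 * t))) with hb
  have hb0 : 0 < b := by positivity
  set a := 2 * Real.exp (-t) / (1 + Real.exp (-2 * t)) with ha
  have ha0 : 0 < a := by positivity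
  set k : EucSpace d → EucSpace d → ℝ≥0∞ := fun x y =>
    ENNReal.ofReal (c * Real.exp (-b * ‖x - a • y‖ ^ 2)) with hkdef
  set h : EucSpace d → ℝ≥0∞ := fun y => ENNReal.ofReal (gaussDensity d α y) ^ (1 / p) * f y
    with hhdef
  have hh : AEMeasurable h volume :=
    ((continuous_gaussDensity d α).measurable.ennreal_ofReal.pow_const _).aemeasurable.mul hf
  have hk : Measurable (Function.uncurry k) := by
    simp only [hkdef, Function.uncurry_def]
    fun_prop
  have hkq : ∀ x y, k x y ^ q = ENNReal.ofReal (c ^ q)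
      * ENNReal.ofReal (Real.exp (-(q * b) * ‖x - a • y‖ ^ 2)) := fun x y => by
    simp only [hkdef]
    rw [ENNReal.ofReal_rpow_of_nonneg (by positivity) hq0.le, Real.mul_rpow hc0.le
      (Real.exp_pos _).le, ← Real.exp_mul, ENNReal.ofReal_mul (by positivity)]
    ring_nf
  have hB : ∀ y, ∫⁻ x, k x y ^ q
      ≤ ENNReal.ofReal (c ^ q * (Real.pi / (q * b)) ^ ((d : ℝ) / 2)) := fun y => by
    simp_rw [hkq]
    rw [lintegral_const_mul _ (by fun_prop), lintegral_exp_neg_mul_sq_norm (by positivity),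
      ENNReal.ofReal_mul (by positivity)]
  -- Integrating in y rather than in x costs the Jacobian a^(-d) of the dilation.
  have hA : ∀ x, ∫⁻ y, k x y ^ q
      ≤ ENNReal.ofReal (c ^ q * (Real.pi / (q * b)) ^ ((d : ℝ) / 2) * a ^ (-(d : ℝ))) :=
    fun x => by
      have e : ∀ y, ‖x - a • y‖ ^ 2 = a ^ 2 * ‖y - a⁻¹ • x‖ ^ 2 := fun y => by
        rw [← sq_abs a, ← mul_pow, ← Real.norm_eq_abs, ← norm_smul, smul_sub, smul_smul,
          mul_inv_cancel₀ ha0.ne', one_smul, norm_sub_rev]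
      simp_rw [hkq, e, ← mul_assoc]
      rw [lintegral_const_mul _ (by fun_prop)]
      have e2 : ∀ y, -(q * b) * a ^ 2 * ‖y - a⁻¹ • x‖ ^ 2
          = -(q * b * a ^ 2) * ‖y - a⁻¹ • x‖ ^ 2 := fun y => by ring
      simp_rw [e2]
      rw [lintegral_exp_neg_mul_sq_norm (by positivity), ← ENNReal.ofReal_mul (by positivity)]
      refine le_of_eq (congrArg ENNReal.ofReal ?_)
      rw [mul_assoc (c ^ q), ← div_div, Real.div_rpow (by positivity) (by positivity),
        ← Real.rpow_natCast, ← Real.rpow_mul ha0.le, Real.rpow_neg ha0.le, div_eq_mul_inv]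
      rw [Nat.cast_two, mul_div_cancel₀ (d : ℝ) two_ne_zero]
  have hmain := lintegral_kernel_sq_le (μ := volume) (ν := volume) hk hh hp hp2 hq hq2 hpq hA hB
  -- The output density is moved inside the square as its square root, and the p-th root of the
  -- input density is divided out of the kernel and put into h.
  have hLHS : ∫⁻ x, (∫⁻ y, ENNReal.ofReal (mehlerKernel t x y) * f y) ^ (2 : ℝ) ∂(gaussMeasure d 1)
      = ∫⁻ x, (∫⁻ y, k x y * h y) ^ (2 : ℝ) := by
    rw [lintegral_gaussMeasure]
    refine lintegral_congr fun x => ?_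
    have g1 := gaussDensity_pos one_pos x
    have e1 : ENNReal.ofReal (gaussDensity d 1 x)
        = ENNReal.ofReal (gaussDensity d 1 x ^ (1 / 2 : ℝ)) ^ (2 : ℝ) := by
      rw [ENNReal.ofReal_rpow_of_nonneg (by positivity) (by norm_num), ← Real.rpow_mul g1.le]
      norm_num
    rw [e1, ← ENNReal.mul_rpow_of_nonneg _ _ (by norm_num),
      ← lintegral_const_mul' _ _ ENNReal.ofReal_ne_top]
    congr 1
    refine lintegral_congr fun y => ?_
    have g2 := gaussDensity_pos hα0 y
    simp only [hkdef, hhdef]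
    rw [← hweight, ENNReal.ofReal_rpow_of_nonneg g2.le (by positivity), ← mul_assoc, ← mul_assoc,
      ← ENNReal.ofReal_mul (by positivity), ← ENNReal.ofReal_mul (by
        have := mehlerKernel_pos ht x y
        positivity)]
    congr 2
    rw [mul_assoc _ _ (gaussDensity d α y ^ (1 / p)), ← Real.rpow_add g2]
    simp
  have hP : ∫⁻ y, h y ^ p = ∫⁻ y, f y ^ p ∂(gaussMeasure d α) := by
    rw [lintegral_gaussMeasure]
    refine lintegral_congr fun y => ?_
    simp only [hhdef]
    rw [ENNReal.mul_rpow_of_nonneg _ _ hp0.le, ← ENNReal.rpow_mul, one_div_mul_cancel hp0.ne',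
      ENNReal.rpow_one]
  rw [hLHS, ← hP]
  refine hmain.trans ?_
  gcongr
  have hu : 0 ≤ 1 / q - 1 / 2 := by
    have := one_div_le_one_div_of_le hq0 hq2
    linarith
  rw [ENNReal.ofReal_rpow_of_nonneg (by positivity) hu,
    ENNReal.ofReal_rpow_of_nonneg (by positivity) (by norm_num),
    ← ENNReal.ofReal_mul (by positivity)]
  refine ENNReal.ofReal_le_ofReal (le_trans (le_of_eq ?_) hle)
  set D := c ^ q * (Real.pi / (q * b)) ^ ((d : ℝ) / 2) with hD
  have hD0 : 0 < D := by positivity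
  have e1 : D ^ (1 / q) = c * (Real.pi / (q * b)) ^ ((d : ℝ) / 2 * (1 / q)) := by
    rw [hD, Real.mul_rpow (by positivity) (by positivity), ← Real.rpow_mul hc0.le,
      ← Real.rpow_mul (by positivity), mul_one_div_cancel hq0.ne', Real.rpow_one]
  rw [Real.mul_rpow hD0.le (by positivity), ← Real.rpow_mul ha0.le, mul_right_comm,
    ← Real.rpow_add hD0, sub_add_cancel, e1, neg_mul]

/-! ### The operators given by the Mehler formula -/

theorem mehlerIntegral_congr {d : ℕ} {t : ℝ} {f g : EucSpace d → ℂ} (h : f =ᵐ[volume] g) :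
    mehlerIntegral t f = mehlerIntegral t g := by
  funext x
  refine integral_congr_ae ?_
  filter_upwards [h] with y hy
  rw [hy]

section MehlerEstimates

variable {d : ℕ} {t : ℝ} {p : ℝ≥0∞} {f : EucSpace d → ℂ}

theorem aestronglyMeasurable_mehler_integrand (t : ℝ) (hf : AEStronglyMeasurable f volume) :
    AEStronglyMeasurable (fun z : EucSpace d × EucSpace d => (mehlerKernel t z.1 z.2 : ℂ) * f z.2)
      (volume.prod volume) :=
  (Complex.continuous_ofReal.comp (continuous_uncurry_mehlerKernel d t)).aestronglyMeasurable.mul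
    hf.comp_snd

theorem enorm_mehler_integrand (ht : 0 < t) (x y : EucSpace d) :
    ‖(mehlerKernel t x y : ℂ) * f y‖ₑ = ENNReal.ofReal (mehlerKernel t x y) * ‖f y‖ₑ := by
  rw [enorm_mul]
  congr 1
  rw [← ofReal_norm, Complex.norm_real, Real.norm_of_nonneg (mehlerKernel_pos ht x y).le]

theorem lintegral_mehler_sq_rpow_le (ht : 0 < t) (hp : 1 ≤ p) (hp2 : p ≤ 2)
    (hf : AEStronglyMeasurable f volume) :
    (∫⁻ x, (∫⁻ y, ‖(mehlerKernel t x y : ℂ) * f y‖ₑ) ^ (2 : ℝ) ∂(gaussMeasure d 1))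
        ^ (1 / 2 : ℝ)
      ≤ ENNReal.ofReal (ouBound d (1 / p.toReal) t)
        * eLpNorm f p (gaussMeasure d (ouAlpha p t)) := by
  have hpt : p ≠ ∞ := ne_top_of_le_ne_top (by simp) hp2
  have hp1' : 1 ≤ p.toReal := by
    simpa using (ENNReal.toReal_le_toReal (by simp) hpt).2 hp
  have hp2' : p.toReal ≤ 2 := by
    simpa using (ENNReal.toReal_le_toReal hpt (by simp)).2 hp2
  have h := lintegral_mehlerKernel_sq_le ht hp1' hp2' hf.enorm
  simp_rw [enorm_mehler_integrand ht]
  rw [eLpNorm_eq_lintegral_rpow_enorm_toReal (zero_lt_one.trans_le hp).ne' hpt]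
  refine (ENNReal.rpow_le_rpow h (by norm_num)).trans (le_of_eq ?_)
  rw [← ENNReal.rpow_mul]
  norm_num [ouAlpha]

/-- The Young bound was proved for absolute values, so the absolute integral is finite almost
everywhere. Additivity of `mehlerIntegral` depends on this, as the Bochner integral of a
non-integrable function is 0. -/
theorem ae_integrable_mehler_integrand (ht : 0 < t) (hp : 1 ≤ p) (hp2 : p ≤ 2)
    (hf : AEStronglyMeasurable f volume)
    (hfin : eLpNorm f p (gaussMeasure d (ouAlpha p t)) < ∞) :
    ∀ᵐ x, Integrable fun y => (mehlerKernel t x y : ℂ) * f y := by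
  have hm := aestronglyMeasurable_mehler_integrand t hf
  have h1 := (lintegral_mehler_sq_rpow_le ht hp hp2 hf).trans_lt
    (ENNReal.mul_lt_top ENNReal.ofReal_lt_top hfin)
  rw [ENNReal.rpow_lt_top_iff_of_pos (by norm_num)] at h1
  have hme : AEMeasurable (fun x => ∫⁻ y, ‖(mehlerKernel t x y : ℂ) * f y‖ₑ) volume :=
    hm.enorm.lintegral_prod_right'
  have h2 := ae_lt_top' ((hme.mono_ac (gaussMeasure_absolutelyContinuous d 1)).pow_const _) h1.ne
  have h3 := (ae_gaussMeasure_iff one_pos).1 h2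
  filter_upwards [h3, hm.prodMk_left] with x hx hmx
  refine ⟨hmx, ?_⟩
  rwa [ENNReal.rpow_lt_top_iff_of_pos (by norm_num)] at hx

theorem aestronglyMeasurable_mehlerIntegral (t : ℝ) (hf : AEStronglyMeasurable f volume) :
    AEStronglyMeasurable (mehlerIntegral t f) volume :=
  (aestronglyMeasurable_mehler_integrand t hf).integral_prod_right'

theorem eLpNorm_mehlerIntegral_le (ht : 0 < t) (hp : 1 ≤ p) (hp2 : p ≤ 2)
    (hf : AEStronglyMeasurable f volume) :
    eLpNorm (mehlerIntegral t f) 2 (gaussMeasure d 1)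
      ≤ ENNReal.ofReal (ouBound d (1 / p.toReal) t)
        * eLpNorm f p (gaussMeasure d (ouAlpha p t)) := by
  refine le_trans ?_ (lintegral_mehler_sq_rpow_le ht hp hp2 hf)
  rw [eLpNorm_eq_lintegral_rpow_enorm_toReal (by simp) (by simp)]
  simp only [ENNReal.toReal_ofNat]
  gcongr with x
  exact enorm_integral_le_lintegral_enorm _

end MehlerEstimates

/-- The measure μ is left free so that one construction serves twice: with μ = γ_α and K = 1 for the
final bounds, and with p = 2 and μ = γ to define the operators on L²(γ). -/
theorem exists_mehler_clm {d : ℕ} {t : ℝ} (ht : 0 < t) {p : ℝ≥0∞} [Fact (1 ≤ p)] (hp2 : p ≤ 2)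
    {μ : Measure (EucSpace d)} (hμ : volume ≪ μ) {K : ℝ} (hK0 : 0 ≤ K)
    (hK : ∀ f : EucSpace d → ℂ,
      eLpNorm f p (gaussMeasure d (ouAlpha p t)) ≤ ENNReal.ofReal K * eLpNorm f p μ) :
    ∃ S : Lp ℂ p μ →L[ℂ] GaussL2 d, ‖S‖ ≤ ouBound d (1 / p.toReal) t * K ∧
      ∀ f : Lp ℂ p μ, S f =ᵐ[gaussMeasure d 1] mehlerIntegral t f := by
  have hp : 1 ≤ p := Fact.out
  have hm : ∀ f : Lp ℂ p μ, AEStronglyMeasurable f volume := fun f =>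
    (Lp.aestronglyMeasurable f).mono_ac hμ
  have hN := (ouBound_pos d (1 / p.toReal) ht).le
  have hle : ∀ f : Lp ℂ p μ, eLpNorm (mehlerIntegral t f) 2 (gaussMeasure d 1)
      ≤ ENNReal.ofReal (ouBound d (1 / p.toReal) t * K) * eLpNorm f p μ := fun f => by
    refine (eLpNorm_mehlerIntegral_le ht hp hp2 (hm f)).trans ?_
    rw [ENNReal.ofReal_mul hN, mul_assoc]
    gcongr
    exact hK f
  have hmem : ∀ f : Lp ℂ p μ, MemLp (mehlerIntegral t f) 2 (gaussMeasure d 1) := fun f =>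
    ⟨(aestronglyMeasurable_mehlerIntegral t (hm f)).mono_ac
      (gaussMeasure_absolutelyContinuous d 1),
      (hle f).trans_lt (ENNReal.mul_lt_top ENNReal.ofReal_lt_top (Lp.eLpNorm_lt_top f))⟩
  have hint : ∀ f : Lp ℂ p μ, ∀ᵐ x ∂(gaussMeasure d 1),
      Integrable fun y => (mehlerKernel t x y : ℂ) * f y := fun f =>
    (ae_gaussMeasure_iff one_pos).2 <| ae_integrable_mehler_integrand ht hp hp2 (hm f)
      ((hK f).trans_lt (ENNReal.mul_lt_top ENNReal.ofReal_lt_top (Lp.eLpNorm_lt_top f)))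
  refine ⟨LinearMap.mkContinuous
    { toFun := fun f => (hmem f).toLp _
      map_add' := fun f g => ?_
      map_smul' := fun c f => ?_ } (ouBound d (1 / p.toReal) t * K) fun f => ?_,
    LinearMap.mkContinuous_norm_le _ (by positivity) _, fun f => MemLp.coeFn_toLp (hmem f)⟩
  · rw [← MemLp.toLp_add, MemLp.toLp_eq_toLp_iff,
      mehlerIntegral_congr (hμ.ae_le (Lp.coeFn_add f g))]
    filter_upwards [hint f, hint g] with x h1 h2
    simp only [mehlerIntegral, Pi.add_apply, mul_add]
    exact integral_add h1 h2
  · rw [RingHom.id_apply, ← MemLp.toLp_const_smul, MemLp.toLp_eq_toLp_iff,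
      mehlerIntegral_congr (hμ.ae_le (Lp.coeFn_smul c f))]
    refine Eventually.of_forall fun x => ?_
    simp only [mehlerIntegral, Pi.smul_apply, smul_eq_mul]
    rw [← integral_const_mul]
    congr 1
    funext y
    ring
  · simp only [LinearMap.coe_mk, AddHom.coe_mk]
    rw [Lp.norm_toLp, Lp.norm_def, ← ENNReal.toReal_ofReal (show 0 ≤ ouBound d (1 / p.toReal) t * K
      by positivity), ← ENNReal.toReal_mul]
    refine ENNReal.toReal_mono ?_ (hle f)
    exact (ENNReal.mul_lt_top ENNReal.ofReal_lt_top (Lp.eLpNorm_lt_top f)).ne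

/-! ### Mehler operators on L²(γ) and their action on characters. -/

theorem mehlerIntegral_planeWave {d : ℕ} {t : ℝ} (ht : 0 < t) (ξ x : EucSpace d) :
    mehlerIntegral t (planeWave ξ) x
      = (Real.exp (-(1 - Real.exp (-2 * t)) * ‖ξ‖ ^ 2 / 2) : ℝ)
        * planeWave (Real.exp (-t) • ξ) x := by
  have h1 := one_sub_exp_pos ht
  rw [mehlerIntegral, ← integral_add_right_eq_self _ (Real.exp (-t) • x)]
  generalize hσ : 1 - Real.exp (-2 * t) = σ at *
  have hpi : 0 < Real.pi := Real.pi_pos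
  have h2 : ∀ y : EucSpace d, (mehlerKernel t x (y + Real.exp (-t) • x) : ℂ)
        * planeWave ξ (y + Real.exp (-t) • x)
      = (((2 * Real.pi * σ) ^ (-((d : ℝ) / 2)) : ℝ) : ℂ) * planeWave (Real.exp (-t) • ξ) x
        * Complex.exp (-((1 / (2 * σ) : ℝ) : ℂ) * (‖y‖ : ℂ) ^ 2 + Complex.I * (⟪ξ, y⟫ : ℂ)) :=
    fun y => by
      rw [mehlerKernel, add_sub_cancel_right, hσ, planeWave, planeWave, Complex.exp_add,
        inner_add_right, real_inner_smul_right, real_inner_smul_left]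
      push_cast
      rw [add_mul, Complex.exp_add]
      have : -((‖y‖ : ℂ) ^ 2 / (2 * (σ : ℂ))) = -(1 / (2 * (σ : ℂ))) * (‖y‖ : ℂ) ^ 2 := by ring
      rw [this, mul_comm Complex.I]
      ring
  simp_rw [h2]
  rw [integral_const_mul, GaussianFourier.integral_cexp_neg_mul_sq_norm_add (V := EucSpace d)
    (by rw [Complex.ofReal_re]; positivity)]
  have h3 : ((Real.pi : ℂ) / ((1 / (2 * σ) : ℝ) : ℂ)) ^ ((Module.finrank ℝ (EucSpace d) : ℂ) / 2)
      = (((2 * Real.pi * σ) ^ ((d : ℝ) / 2) : ℝ) : ℂ) := by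
    have : (Real.pi : ℂ) / ((1 / (2 * σ) : ℝ) : ℂ) = ((2 * Real.pi * σ : ℝ) : ℂ) := by
      rw [← Complex.ofReal_div]
      congr 1
      field_simp
    rw [Complex.ofReal_cpow (by positivity), this]
    simp
  have h4 : (((2 * Real.pi * σ) ^ (-((d : ℝ) / 2)) : ℝ) : ℂ)
      * (((2 * Real.pi * σ) ^ ((d : ℝ) / 2) : ℝ) : ℂ) = 1 := by
    rw [← Complex.ofReal_mul, ← Real.rpow_add (by positivity)]
    simp
  have h5 : Complex.exp (Complex.I ^ 2 * (‖ξ‖ : ℂ) ^ 2 / (4 * ((1 / (2 * σ) : ℝ) : ℂ)))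
      = ((Real.exp (-σ * ‖ξ‖ ^ 2 / 2) : ℝ) : ℂ) := by
    have : (σ : ℂ) ≠ 0 := by exact_mod_cast h1.ne'
    push_cast
    congr 1
    rw [Complex.I_sq]
    field_simp
    ring
  rw [h3, h5]
  linear_combination planeWave (Real.exp (-t) • ξ) x
    * ((Real.exp (-σ * ‖ξ‖ ^ 2 / 2) : ℝ) : ℂ) * h4

theorem gaussMeasure_le_smul {d : ℕ} {α : ℝ} (h1 : 1 / 2 ≤ α) (h2 : α ≤ 1) :
    gaussMeasure d α ≤ ENNReal.ofReal (2 ^ ((d : ℝ) / 2)) • gaussMeasure d 1 := by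
  have hα : 0 < α := by linarith
  have hd : (0 : ℝ) ≤ d := Nat.cast_nonneg d
  rw [gaussMeasure, gaussMeasure, ← withDensity_smul _ (by fun_prop)]
  refine withDensity_mono (Eventually.of_forall fun x => ?_)
  rw [Pi.smul_apply, smul_eq_mul, ← ENNReal.ofReal_mul (by positivity)]
  refine ENNReal.ofReal_le_ofReal ?_
  have hpi : 0 < Real.pi := Real.pi_pos
  rw [Real.mul_rpow (by positivity) hα.le, mul_one (2 * Real.pi)]
  have e1 : α ^ (-((d : ℝ) / 2)) ≤ 2 ^ ((d : ℝ) / 2) := by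
    calc α ^ (-((d : ℝ) / 2)) ≤ (1 / 2) ^ (-((d : ℝ) / 2)) :=
          Real.rpow_le_rpow_of_nonpos (by norm_num) h1 (by linarith)
      _ = _ := by rw [one_div, Real.inv_rpow zero_le_two, Real.rpow_neg zero_le_two, inv_inv]
  have e2 : Real.exp (-(‖x‖ ^ 2 / (2 * α))) ≤ Real.exp (-(‖x‖ ^ 2 / (2 * 1))) := by
    gcongr
  calc _ ≤ (2 * Real.pi) ^ (-((d : ℝ) / 2)) * 2 ^ ((d : ℝ) / 2)
        * Real.exp (-(‖x‖ ^ 2 / (2 * 1))) := by gcongr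
    _ = _ := by ring

/-- The Young bound for p = 2 has source space L²(γ_α) with α = (1 + e^{-2t})/2 in [1/2, 1], where
γ_α ≤ 2^(d/2) γ. The resulting constant is not the contraction bound, but local boundedness in t is
all that strong continuity needs. -/
theorem exists_mehler_clm_gaussL2 {d : ℕ} {t : ℝ} (ht : 0 < t) :
    ∃ S : GaussL2 d →L[ℂ] GaussL2 d,
      ‖S‖ ≤ (4 * Real.pi) ^ (d : ℝ) * 2 ^ (d : ℝ) * Real.exp (t * d) ∧
      ∀ f : GaussL2 d, S f =ᵐ[gaussMeasure d 1] mehlerIntegral t f := by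
  have hd : (0 : ℝ) ≤ d := Nat.cast_nonneg d
  have hα : ouAlpha 2 t = (1 + Real.exp (-2 * t)) / 2 := by simp [ouAlpha]
  have hR := Real.exp_pos (-2 * t)
  have h1 := one_sub_exp_pos ht
  obtain ⟨S, hS, hS2⟩ := exists_mehler_clm (d := d) ht (p := 2) le_rfl
    (absolutelyContinuous_gaussMeasure one_pos) (K := (2 ^ ((d : ℝ) / 2)) ^ (1 / 2 : ℝ))
    (by positivity) (fun f => by
      rw [hα]
      refine (eLpNorm_mono_measure f (gaussMeasure_le_smul (by linarith) (by linarith))).trans ?_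
      rw [eLpNorm_smul_measure_of_ne_top (by simp), smul_eq_mul,
        ENNReal.ofReal_rpow_of_nonneg (by positivity) (by simp)]
      simp)
  refine ⟨S, hS.trans ?_, hS2⟩
  have hpi : 3 < Real.pi := Real.pi_gt_three
  rw [ouBound]
  simp only [ENNReal.toReal_ofNat, sub_self, mul_zero, neg_zero, Real.rpow_zero, mul_one]
  rw [← Real.rpow_mul zero_le_two, mul_right_comm]
  gcongr
  · norm_num
  · linarith
  · exact mul_le_of_le_one_right hd (by norm_num)

open Classical in
/-- The Ornstein-Uhlenbeck semigroup, given by the Mehler formula. -/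
noncomputable def mehlerOp (d : ℕ) (t : ℝ) : GaussL2 d →L[ℂ] GaussL2 d :=
  if ht : 0 < t then (exists_mehler_clm_gaussL2 (d := d) ht).choose
  else ContinuousLinearMap.id ℂ _

theorem coeFn_mehlerOp {d : ℕ} {t : ℝ} (ht : 0 < t) (f : GaussL2 d) :
    mehlerOp d t f =ᵐ[gaussMeasure d 1] mehlerIntegral t f := by
  rw [mehlerOp, dif_pos ht]
  exact (exists_mehler_clm_gaussL2 (d := d) ht).choose_spec.2 f

theorem mehlerOp_zero (d : ℕ) : mehlerOp d 0 = ContinuousLinearMap.id ℂ _ := by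
  rw [mehlerOp, dif_neg (lt_irrefl _)]

theorem norm_mehlerOp_le {d : ℕ} {t : ℝ} (ht : 0 ≤ t) :
    ‖mehlerOp d t‖ ≤ (4 * Real.pi) ^ (d : ℝ) * 2 ^ (d : ℝ) * Real.exp (t * d) := by
  rcases ht.eq_or_lt with rfl | ht
  · rw [mehlerOp_zero]
    refine ContinuousLinearMap.norm_id_le.trans ?_
    have hd : (0 : ℝ) ≤ d := Nat.cast_nonneg d
    have h1 : 1 ≤ (4 * Real.pi) ^ (d : ℝ) :=
      Real.one_le_rpow (by linarith [Real.pi_gt_three]) hd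
    have h2 : 1 ≤ (2 : ℝ) ^ (d : ℝ) := Real.one_le_rpow (by norm_num) hd
    rw [zero_mul, Real.exp_zero, mul_one]
    exact one_le_mul_of_one_le_of_one_le h1 h2
  · rw [mehlerOp, dif_pos ht]
    exact (exists_mehler_clm_gaussL2 (d := d) ht).choose_spec.1

/-- The damping factor of `exp (-tL)` acting on a character. -/
noncomputable def mehlerDamping {d : ℕ} (t : ℝ) (ξ : EucSpace d) : ℝ :=
  Real.exp (-(1 - Real.exp (-2 * t)) * ‖ξ‖ ^ 2 / 2)

theorem mehlerOp_waveL2 {d : ℕ} {t : ℝ} (ht : 0 ≤ t) (ξ : EucSpace d) :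
    mehlerOp d t (waveL2 ξ) = (mehlerDamping t ξ : ℂ) • waveL2 (Real.exp (-t) • ξ) := by
  rcases ht.eq_or_lt with rfl | ht
  · simp [mehlerOp_zero, mehlerDamping]
  · refine Lp.ext ?_
    filter_upwards [coeFn_mehlerOp ht (waveL2 ξ), coeFn_waveL2 (Real.exp (-t) • ξ),
      Lp.coeFn_smul (mehlerDamping t ξ : ℂ) (waveL2 (Real.exp (-t) • ξ))] with x h1 h2 h3
    rw [h1, h3, Pi.smul_apply, h2, mehlerIntegral_congr ((absolutelyContinuous_gaussMeasure
      one_pos).ae_le (coeFn_waveL2 ξ)), mehlerIntegral_planeWave ht, smul_eq_mul]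
    rfl

/-! ### The graph of the Ornstein-Uhlenbeck operator -/

theorem laplacian_eq_sum_fderiv {d : ℕ} {f : EucSpace d → ℂ} (hf : ContDiff ℝ 2 f)
    (x : EucSpace d) :
    (Δ f) x = ∑ i, fderiv ℝ (fun y => fderiv ℝ f y (stdOrthonormalBasis ℝ (EucSpace d) i)) x
      (stdOrthonormalBasis ℝ (EucSpace d) i) := by
  rw [InnerProductSpace.laplacian_eq_iteratedFDeriv_stdOrthonormalBasis]
  refine Finset.sum_congr rfl fun i _ => ?_
  have h : DifferentiableAt ℝ (fderiv ℝ f) x :=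
    ((hf.fderiv_right (m := 1) (by norm_num)).differentiable (by norm_num)) x
  rw [iteratedFDeriv_two_apply, fderiv_clm_apply h (differentiableAt_const _)]
  simp

theorem continuous_ouExpr {d : ℕ} {f : EucSpace d → ℂ} (hf : ContDiff ℝ 2 f) :
    Continuous (ouExpr f) := by
  have h1 : Continuous (Δ f) := by
    rw [funext (laplacian_eq_sum_fderiv hf)]
    refine continuous_finsetSum _ fun i _ => ?_
    have h : ContDiff ℝ 1 fun y => fderiv ℝ f y (stdOrthonormalBasis ℝ (EucSpace d) i) :=
      (hf.fderiv_right (m := 1) (by norm_num)).clm_apply contDiff_const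
    exact (h.continuous_fderiv (by norm_num)).clm_apply continuous_const
  have h2 : Continuous fun x => fderiv ℝ f x x :=
    (hf.continuous_fderiv (by norm_num)).clm_apply continuous_id
  exact h1.neg.add h2

theorem ouExpr_congr {d : ℕ} {f g : EucSpace d → ℂ} {x : EucSpace d} (h : f =ᶠ[𝓝 x] g) :
    ouExpr f x = ouExpr g x := by
  rw [ouExpr, ouExpr, h.fderiv_eq, (InnerProductSpace.laplacian_congr_nhds h).eq_of_nhds]

theorem norm_ouExpr_le {d : ℕ} {f : EucSpace d → ℂ} {x : EucSpace d} {A B : ℝ}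
    (hA : ‖iteratedFDeriv ℝ 1 f x‖ ≤ A) (hB : ‖iteratedFDeriv ℝ 2 f x‖ ≤ B) :
    ‖ouExpr f x‖ ≤ (A + d * B) * (1 + ‖x‖) := by
  have hA0 : 0 ≤ A := (norm_nonneg _).trans hA
  have hB0 : 0 ≤ B := (norm_nonneg _).trans hB
  have h1 : ‖(Δ f) x‖ ≤ d * B := by
    rw [InnerProductSpace.laplacian_eq_iteratedFDeriv_stdOrthonormalBasis]
    refine (norm_sum_le _ _).trans ?_
    refine (Finset.sum_le_card_nsmul _ _ B fun i _ => ?_).trans (le_of_eq (by simp))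
    refine ((iteratedFDeriv ℝ 2 f x).le_opNorm _).trans ?_
    simpa [Fin.prod_univ_two] using hB
  have h2 : ‖fderiv ℝ f x x‖ ≤ A * ‖x‖ := by
    refine ((fderiv ℝ f x).le_opNorm x).trans ?_
    rw [norm_iteratedFDeriv_one] at hA
    gcongr
  rw [ouExpr]
  refine (norm_add_le _ _).trans ?_
  rw [norm_neg]
  nlinarith [norm_nonneg x, mul_nonneg (mul_nonneg (Nat.cast_nonneg (α := ℝ) d) hB0)
    (norm_nonneg x)]

theorem ouExpr_planeWave {d : ℕ} (ξ : EucSpace d) : ouExpr (planeWave ξ) = ouWave ξ := by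
  funext x
  have h1 : ∀ v y : EucSpace d, fderiv ℝ (planeWave ξ) y v
      = planeWave ξ y * (Complex.I * (⟪ξ, v⟫ : ℂ)) := fun v y => by
    rw [(hasFDerivAt_planeWave ξ y).fderiv]
    simp
  rw [ouExpr, laplacian_eq_sum_fderiv (contDiff_planeWave ξ 2), h1, ouWave]
  have h2 : ∀ v : EucSpace d, fderiv ℝ (fun y => fderiv ℝ (planeWave ξ) y v) x v
      = -((⟪ξ, v⟫ * ⟪v, ξ⟫ : ℝ) : ℂ) * planeWave ξ x := fun v => by
    simp_rw [h1]
    rw [fderiv_mul_const (hasFDerivAt_planeWave ξ x).differentiableAt]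
    rw [smul_apply, h1, real_inner_comm ξ v, smul_eq_mul]
    push_cast
    linear_combination (⟪ξ, v⟫ : ℂ) ^ 2 * planeWave ξ x * Complex.I_sq
  simp_rw [h2]
  rw [← Finset.sum_mul, Finset.sum_neg_distrib, ← Complex.ofReal_sum,
    OrthonormalBasis.sum_inner_mul_inner, real_inner_self_eq_norm_sq]
  push_cast
  ring

theorem conj_ouWave {d : ℕ} (ξ x : EucSpace d) :
    (starRingEnd ℂ) (ouWave ξ x)
      = ((‖ξ‖ : ℂ) ^ 2 - (⟪ξ, x⟫ : ℂ) * Complex.I) * planeWave (-ξ) x := by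
  rw [ouWave, map_mul, conj_planeWave]
  simp [sub_eq_add_neg]

/-- Symmetry of L against a character, one direction at a time. In the first integration by parts
the derivative of the Gaussian weight cancels the drift term, leaving i⟨η, v⟩ times a first
derivative; a second one moves that derivative off f. Compact support of f removes the boundary
terms. -/
theorem integral_gaussWave_second_order {d : ℕ} {f : EucSpace d → ℂ} (hf : ContDiff ℝ 2 f)
    (hfc : HasCompactSupport f) (η v : EucSpace d) :
    ∫ x, gaussWave (-η) x * (-(fderiv ℝ (fun y => fderiv ℝ f y v) x v)
        + (⟪x, v⟫ : ℂ) * fderiv ℝ f x v)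
      = ∫ x, ((⟪η, v⟫ : ℂ) ^ 2 - (⟪η, v⟫ : ℂ) * (⟪x, v⟫ : ℂ) * Complex.I)
          * (gaussWave (-η) x * f x) := by
  set ψ : EucSpace d → ℂ := gaussWave (-η) with hψ
  have hψc : Continuous ψ := continuous_gaussWave _
  set g : EucSpace d → ℂ := fun y => fderiv ℝ f y v with hg
  have hgC : ContDiff ℝ 1 g :=
    (hf.fderiv_right (m := 1) (by norm_num)).clm_apply contDiff_const
  have hgc : HasCompactSupport g := hfc.fderiv_apply ℝ v
  have hg2 : Continuous fun x => fderiv ℝ g x v :=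
    (hgC.continuous_fderiv (by norm_num)).clm_apply continuous_const
  have hg2c : HasCompactSupport fun x => fderiv ℝ g x v := hgc.fderiv_apply ℝ v
  have hψ' : ∀ x, fderiv ℝ ψ x v = ψ x * (-(⟪x, v⟫ : ℂ) - (⟪η, v⟫ : ℂ) * Complex.I) := fun x => by
    rw [hψ, fderiv_gaussWave, inner_neg_left]
    push_cast
    ring
  have hψ'c : Continuous fun x => fderiv ℝ ψ x v := by
    simp_rw [hψ']; fun_prop
  have hψd : ∀ x, DifferentiableAt ℝ ψ x := fun x => (hasFDerivAt_gaussWave _ x).differentiableAt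
  have hI : ∀ {a b : EucSpace d → ℂ}, Continuous a → Continuous b → HasCompactSupport b →
      Integrable fun x => a x * b x := fun ha hb hc =>
    (ha.mul hb).integrable_of_hasCompactSupport hc.mul_left
  have hgcont := hgC.continuous
  have hfcont := hf.continuous
  have s1 : ∫ x, ψ x * fderiv ℝ g x v = -∫ x, fderiv ℝ ψ x v * g x :=
    integral_mul_fderiv_eq_neg_fderiv_mul_of_integrable (hI hψ'c hgcont hgc)
      (hI hψc hg2 hg2c) (hI hψc hgcont hgc) (fun x _ => hψd x)
      (fun x _ => hgC.differentiable (by norm_num) x)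
  have s2 : ∫ x, ψ x * g x = -∫ x, fderiv ℝ ψ x v * f x :=
    integral_mul_fderiv_eq_neg_fderiv_mul_of_integrable (hI hψ'c hfcont hfc)
      (hI hψc hgcont hgc) (hI hψc hfcont hfc) (fun x _ => hψd x)
      (fun x _ => hf.differentiable (by norm_num) x)
  have hx : Continuous fun x : EucSpace d => (⟪x, v⟫ : ℂ) := by fun_prop
  have e1 : ∀ x, ψ x * (-(fderiv ℝ g x v) + (⟪x, v⟫ : ℂ) * fderiv ℝ f x v)
      = -(ψ x * fderiv ℝ g x v) + ((⟪x, v⟫ : ℂ) * ψ x) * g x := fun x => by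
    simp only [hg]; ring
  have e2 : ∀ x, fderiv ℝ ψ x v * g x
      = -(((⟪x, v⟫ : ℂ) * ψ x) * g x) - (⟪η, v⟫ : ℂ) * Complex.I * (ψ x * g x) := fun x => by
    rw [hψ']; ring
  have e3 : ∀ x, ((⟪η, v⟫ : ℂ) ^ 2 - (⟪η, v⟫ : ℂ) * (⟪x, v⟫ : ℂ) * Complex.I) * (ψ x * f x)
      = (⟪η, v⟫ : ℂ) * Complex.I * (fderiv ℝ ψ x v * f x) := fun x => by
    rw [hψ']
    linear_combination (⟪η, v⟫ : ℂ) ^ 2 * (ψ x * f x) * Complex.I_sq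
  have j1 : Integrable fun x => -(ψ x * fderiv ℝ g x v) := (hI hψc hg2 hg2c).neg
  have j2 : Integrable fun x => ((⟪x, v⟫ : ℂ) * ψ x) * g x := hI (hx.mul hψc) hgcont hgc
  have j3 : Integrable fun x => -(((⟪x, v⟫ : ℂ) * ψ x) * g x) := j2.neg
  simp_rw [e1, e3]
  rw [integral_add j1 j2, integral_neg, s1,
    integral_const_mul]
  simp_rw [e2]
  rw [integral_sub j3 ((hI hψc hgcont hgc).const_mul _),
    integral_neg, integral_const_mul, s2]
  ring

theorem integral_planeWave_mul_ouExpr {d : ℕ} {f : EucSpace d → ℂ} (hf : ContDiff ℝ 2 f)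
    (hfc : HasCompactSupport f) (η : EucSpace d) :
    ∫ x, planeWave (-η) x * ouExpr f x ∂(gaussMeasure d 1)
      = ∫ x, (starRingEnd ℂ) (ouWave η x) * f x ∂(gaussMeasure d 1) := by
  set b := stdOrthonormalBasis ℝ (EucSpace d) with hb
  have hsum : ∀ (T : EucSpace d →L[ℝ] ℂ) (x : EucSpace d),
      T x = ∑ i, (⟪x, b i⟫ : ℂ) * T (b i) := fun T x => by
    conv_lhs => rw [← b.sum_repr' x, map_sum]
    refine Finset.sum_congr rfl fun i _ => ?_
    rw [map_smul, Complex.real_smul, real_inner_comm]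
  have e1 : ∀ x, (gaussDensity d 1 x : ℂ) * (planeWave (-η) x * ouExpr f x)
      = ((2 * Real.pi) ^ (-((d : ℝ) / 2)) : ℝ) * ∑ i, gaussWave (-η) x *
        (-(fderiv ℝ (fun y => fderiv ℝ f y (b i)) x (b i))
        + (⟪x, b i⟫ : ℂ) * fderiv ℝ f x (b i)) := fun x => by
    rw [← mul_assoc, gaussDensity_mul_planeWave, ← Finset.mul_sum, mul_assoc, ouExpr,
      laplacian_eq_sum_fderiv hf, Finset.sum_add_distrib, Finset.sum_neg_distrib]
    congr 4
    exact hsum _ x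
  have e2 : ∀ x, (gaussDensity d 1 x : ℂ) * ((starRingEnd ℂ) (ouWave η x) * f x)
      = ((2 * Real.pi) ^ (-((d : ℝ) / 2)) : ℝ) * ∑ i,
        ((⟪η, b i⟫ : ℂ) ^ 2 - (⟪η, b i⟫ : ℂ) * (⟪x, b i⟫ : ℂ) * Complex.I)
          * (gaussWave (-η) x * f x) := fun x => by
    have h1 := b.sum_inner_mul_inner η η
    have h2 := b.sum_inner_mul_inner η x
    have h3 : ∑ i, ((⟪η, b i⟫ : ℂ) ^ 2 - (⟪η, b i⟫ : ℂ) * (⟪x, b i⟫ : ℂ) * Complex.I)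
        = (‖η‖ : ℂ) ^ 2 - (⟪η, x⟫ : ℂ) * Complex.I := by
      rw [Finset.sum_sub_distrib, ← Finset.sum_mul, ← h2, ← Complex.ofReal_pow,
        ← real_inner_self_eq_norm_sq η, ← h1]
      push_cast
      congr 1
      · refine Finset.sum_congr rfl fun i _ => ?_
        rw [real_inner_comm η (b i), sq]
      · congr 1
        refine Finset.sum_congr rfl fun i _ => ?_
        rw [real_inner_comm x (b i)]
    rw [← Finset.sum_mul, h3, conj_ouWave]
    linear_combination ((‖η‖ : ℂ) ^ 2 - (⟪η, x⟫ : ℂ) * Complex.I) * f x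
      * gaussDensity_mul_planeWave (-η) x
  rw [integral_gaussMeasure one_pos, integral_gaussMeasure one_pos]
  simp_rw [e1, e2]
  rw [integral_const_mul, integral_const_mul, integral_finsetSum, integral_finsetSum]
  · congr 1
    exact Finset.sum_congr rfl fun i _ => integral_gaussWave_second_order hf hfc η (b i)
  · intro i _
    have h1 := continuous_gaussWave (-η)
    have h2 := hf.continuous
    refine Continuous.integrable_of_hasCompactSupport (by fun_prop) ?_
    exact (hfc.mul_left).mul_left
  · intro i _
    have h1 := continuous_gaussWave (-η)
    have hgC : ContDiff ℝ 1 (fun y => fderiv ℝ f y (b i)) :=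
      (hf.fderiv_right (m := 1) (by norm_num)).clm_apply contDiff_const
    have h2 := hgC.continuous
    have h3 : Continuous fun x => fderiv ℝ (fun y => fderiv ℝ f y (b i)) x (b i) :=
      (hgC.continuous_fderiv (by norm_num)).clm_apply continuous_const
    have hgc : HasCompactSupport (fun y => fderiv ℝ f y (b i)) := hfc.fderiv_apply ℝ (b i)
    refine Continuous.integrable_of_hasCompactSupport (by fun_prop) ?_
    exact ((hgc.fderiv_apply ℝ (b i)).neg.add hgc.mul_left).mul_left

/-- Symmetry against characters is a closed condition on the pair u, so it passes from the core to
the closure. It yields closability and later replaces self-adjointness of L. -/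
theorem inner_waveL2_eq_of_mem_closure {d : ℕ} {u : GaussL2 d × GaussL2 d}
    (hu : u ∈ (ouCoreGraph d).topologicalClosure) (η : EucSpace d) :
    inner ℂ (waveL2 η) u.2 = inner ℂ (ouWaveL2 η) u.1 := by
  have hcl : IsClosed {u : GaussL2 d × GaussL2 d |
      inner ℂ (waveL2 η) u.2 = inner ℂ (ouWaveL2 η) u.1} :=
    isClosed_eq (by fun_prop) (by fun_prop)
  refine closure_minimal ?_ hcl hu
  rintro u ⟨f, hf, hfc, h1, h2⟩
  change inner ℂ (waveL2 η) u.2 = inner ℂ (ouWaveL2 η) u.1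
  rw [inner_waveL2_left, L2.inner_def]
  have e1 : ∫ x, planeWave (-η) x * u.2 x ∂(gaussMeasure d 1)
      = ∫ x, planeWave (-η) x * ouExpr f x ∂(gaussMeasure d 1) := by
    refine integral_congr_ae ?_
    filter_upwards [h2] with x hx
    rw [hx]
  rw [e1, integral_planeWave_mul_ouExpr hf hfc]
  refine integral_congr_ae ?_
  filter_upwards [h1, coeFn_ouWaveL2 η] with x hx hx2
  rw [hx, hx2, RCLike.inner_apply, mul_comm]

theorem ext_inner_waveL2 {d : ℕ} {f g : GaussL2 d}
    (h : ∀ η : EucSpace d, inner ℂ (waveL2 η) f = inner ℂ (waveL2 η) g) : f = g := by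
  have h1 : f - g ∈ (Submodule.span ℂ (range (waveL2 : EucSpace d → GaussL2 d)))ᗮ := by
    rw [Submodule.mem_orthogonal]
    intro u hu
    induction hu using Submodule.span_induction with
    | mem x hx =>
      obtain ⟨η, rfl⟩ := hx
      rw [inner_sub_right, h, sub_self]
    | zero => simp
    | add x y _ _ hx hy => rw [inner_add_left, hx, hy, add_zero]
    | smul a x _ hx => rw [inner_smul_left, hx, mul_zero]
  rw [Submodule.topologicalClosure_eq_top_iff.1 (span_waveL2_topologicalClosure d),
    Submodule.mem_bot] at h1
  exact sub_eq_zero.1 h1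

theorem graph_ouOperator (d : ℕ) :
    (ouOperator d).graph = (ouCoreGraph d).topologicalClosure := by
  -- Closability must be proved: for a non-closable operator `LinearPMap.closure` returns the
  -- operator itself. If u.1 = 0, symmetry makes u.2 orthogonal to every character.
  have hc : (ouCoreGraph d).toLinearPMap.IsClosable := by
    refine ⟨(ouCoreGraph d).topologicalClosure.toLinearPMap, ?_⟩
    rw [ouCore_graph, Submodule.toLinearPMap_graph_eq]
    intro u hu h0
    refine ext_inner_waveL2 fun η => ?_
    rw [inner_waveL2_eq_of_mem_closure hu, h0, inner_zero_right, inner_zero_right]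
  rw [ouOperator, ← hc.graph_closure_eq_closure_graph, ouCore_graph]

theorem tendsto_toLp_of_linear_growth {d : ℕ} {F : ℕ → EucSpace d → ℂ} {G : EucSpace d → ℂ}
    {C : ℝ} (hF : ∀ n, Continuous (F n)) (hG : Continuous G)
    (hFm : ∀ n, MemLp (F n) 2 (gaussMeasure d 1)) (hGm : MemLp G 2 (gaussMeasure d 1))
    (hFC : ∀ n x, ‖F n x‖ ≤ C * (1 + ‖x‖)) (hlim : ∀ x, ∀ᶠ n in atTop, F n x = G x) :
    Tendsto (fun n => (hFm n).toLp (F n)) atTop (𝓝 (hGm.toLp G)) := by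
  rw [Lp.tendsto_Lp_iff_tendsto_eLpNorm'']
  have hGC : ∀ x, ‖G x‖ ≤ C * (1 + ‖x‖) := fun x => by
    obtain ⟨n, hn⟩ := (hlim x).exists
    rw [← hn]
    exact hFC n x
  have hb : MemLp (fun x : EucSpace d => ((2 * C * (1 + ‖x‖) : ℝ) : ℂ)) 2 (gaussMeasure d 1) :=
    memLp_two_of_linear_growth (C := |2 * C|) (Continuous.aestronglyMeasurable (by fun_prop))
      fun x => by
        rw [Complex.norm_real, Real.norm_eq_abs, abs_mul, abs_of_nonneg
          (by positivity : 0 ≤ 1 + ‖x‖)]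
  have hb2 := hb.2
  rw [eLpNorm_lt_top_iff_lintegral_rpow_enorm_lt_top (by simp) (by simp)] at hb2
  have key := tendsto_lintegral_of_dominated_convergence (μ := gaussMeasure d 1)
    (F := fun n x => ‖(F n - G) x‖ₑ ^ (2 : ℝ)) (f := fun _ => 0)
    (fun x : EucSpace d => ‖((2 * C * (1 + ‖x‖) : ℝ) : ℂ)‖ₑ ^ (2 : ℝ))
    (fun n => (((hF n).sub hG).enorm.measurable).pow_const _)
    (fun n => Eventually.of_forall fun x => by
      simp only
      gcongr ?_ ^ (2 : ℝ)
      rw [enorm_le_iff_norm_le]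
      refine (norm_sub_le _ _).trans ?_
      rw [Complex.norm_real]
      refine le_trans ?_ (le_abs_self _)
      linarith [hFC n x, hGC x])
    (by simpa using hb2.ne)
    (Eventually.of_forall fun x => by
      refine tendsto_const_nhds.congr' ?_
      filter_upwards [hlim x] with n hn
      simp [hn])
  have h3 := key.ennrpow_const (1 / 2 : ℝ)
  simp only [lintegral_zero] at h3
  rw [ENNReal.zero_rpow_of_pos (by norm_num)] at h3
  refine h3.congr fun n => ?_
  rw [eLpNorm_eq_lintegral_rpow_enorm_toReal (by simp) (by simp)]
  simp

/-- Translating a character multiplies it by a unimodular constant. -/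
theorem norm_iteratedFDeriv_planeWave {d : ℕ} (ξ : EucSpace d) (k : ℕ) (x : EucSpace d) :
    ‖iteratedFDeriv ℝ k (planeWave ξ) x‖ = ‖iteratedFDeriv ℝ k (planeWave ξ) 0‖ := by
  have h1 := iteratedFDeriv_comp_add_right (𝕜 := ℝ) (f := planeWave ξ) k x 0
  have h2 : (fun z => planeWave ξ (z + x)) = planeWave ξ x • planeWave ξ := by
    funext z
    simp only [planeWave, Pi.smul_apply, smul_eq_mul]
    rw [← Complex.exp_add, inner_add_right]
    push_cast
    ring_nf
  rw [zero_add] at h1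
  rw [← h1, h2, iteratedFDeriv_const_smul_apply (contDiff_planeWave ξ _).contDiffAt, norm_smul,
    norm_planeWave, one_mul]

/-- Characters are cut off by χ(x/(n + 1)). The scale is at most 1, so by Leibniz the derivatives of
order up to 2 are bounded uniformly in n, and the images under -Δ + x·∇ grow at most linearly. Near
a fixed point the cut-off is eventually 1, so dominated convergence gives convergence of both
components in L²(γ). -/
theorem waveL2_mem_graph {d : ℕ} (ξ : EucSpace d) :
    (waveL2 ξ, ouWaveL2 ξ) ∈ (ouOperator d).graph := by
  rw [graph_ouOperator]
  let χ : ContDiffBump (0 : EucSpace d) := ⟨1, 2, one_pos, one_lt_two⟩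
  have hχ : ContDiff ℝ 2 χ := χ.contDiff
  choose A hA using fun k : Fin 3 => (hχ.continuous_iteratedFDeriv
    (m := (k : ℕ)) (by exact_mod_cast Nat.lt_succ_iff.1 k.2)).bounded_above_of_compact_support
      (χ.hasCompactSupport.iteratedFDeriv (𝕜 := ℝ) k)
  let a : ℕ → ℝ := fun n => 1 / ((n : ℝ) + 1)
  have ha0 : ∀ n, 0 < a n := fun n => by positivity
  have ha1 : ∀ n, a n ≤ 1 := fun n => by
    rw [div_le_one (by positivity)]
    linarith [Nat.cast_nonneg (α := ℝ) n]
  let F : ℕ → EucSpace d → ℂ := fun n x => χ (a n • x) • planeWave ξ x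
  have hχn : ∀ n, ContDiff ℝ 2 fun x : EucSpace d => χ (a n • x) := fun n =>
    hχ.comp (contDiff_const_smul _)
  have hF : ∀ n, ContDiff ℝ 2 (F n) := fun n => (hχn n).smul (contDiff_planeWave ξ 2)
  have hFc : ∀ n, HasCompactSupport (F n) := fun n =>
    ((χ.hasCompactSupport).comp_smul (ha0 n).ne').smul_right
  have hχk : ∀ n x (k : Fin 3), ‖iteratedFDeriv ℝ k (fun x : EucSpace d => χ (a n • x)) x‖ ≤ A k :=
    fun n x k => by
      rw [iteratedFDeriv_comp_const_smul _ (hχ.of_le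
        (by exact_mod_cast Nat.lt_succ_iff.1 k.2)), norm_smul, norm_pow,
        Real.norm_of_nonneg (ha0 n).le]
      exact (mul_le_of_le_one_left (norm_nonneg _) (pow_le_one₀ (ha0 n).le (ha1 n))).trans
        (hA k _)
  have hFk : ∀ k : Fin 3, ∃ C, ∀ n x, ‖iteratedFDeriv ℝ k (F n) x‖ ≤ C := fun k => by
    refine ⟨∑ i ∈ Finset.range ((k : ℕ) + 1), ((k : ℕ).choose i : ℝ) * A (Fin.ofNat 3 i) *
      ‖iteratedFDeriv ℝ (k - i) (planeWave ξ) 0‖, fun n x => ?_⟩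
    refine (norm_iteratedFDeriv_smul_le (hχn n) (contDiff_planeWave ξ 2) x
      (by exact_mod_cast Nat.lt_succ_iff.1 k.2)).trans ?_
    refine Finset.sum_le_sum fun i hi => ?_
    have hi3 : i < 3 := by
      have := Finset.mem_range.1 hi
      omega
    have h1 := hχk n x (Fin.ofNat 3 i)
    have h2 : ((Fin.ofNat 3 i : Fin 3) : ℕ) = i := by
      simp [Fin.ofNat, Nat.mod_eq_of_lt hi3]
    rw [h2] at h1
    rw [norm_iteratedFDeriv_planeWave]
    gcongr
  obtain ⟨C1, hC1⟩ := hFk 1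
  obtain ⟨C2, hC2⟩ := hFk 2
  have hloc : ∀ x, ∀ᶠ n in atTop, F n =ᶠ[𝓝 x] planeWave ξ := fun x => by
    have hlim : Tendsto (fun n => a n • x) atTop (𝓝 (0 : EucSpace d)) := by
      have := (tendsto_one_div_add_atTop_nhds_zero_nat (𝕜 := ℝ)).smul_const x
      simpa [a] using this
    filter_upwards [hlim (Metric.ball_mem_nhds 0 one_pos)] with n hn
    have h1 := χ.eventuallyEq_one_of_mem_ball hn
    have h2 : Tendsto (fun y : EucSpace d => a n • y) (𝓝 x) (𝓝 (a n • x)) :=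
      (continuous_const_smul _).tendsto x
    filter_upwards [h2 h1] with y hy
    change χ (a n • y) • planeWave ξ y = planeWave ξ y
    have hy' : χ (a n • y) = 1 := hy
    rw [hy', one_smul]
  have hF1 : ∀ n x, ‖F n x‖ ≤ 1 * (1 + ‖x‖) := fun n x => by
    change ‖χ (a n • x) • planeWave ξ x‖ ≤ _
    rw [norm_smul, norm_planeWave, mul_one, Real.norm_of_nonneg χ.nonneg]
    linarith [χ.le_one (x := a n • x), norm_nonneg x]
  have hF2 : ∀ n x, ‖ouExpr (F n) x‖ ≤ (C1 + d * C2) * (1 + ‖x‖) := fun n x =>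
    norm_ouExpr_le (hC1 n x) (hC2 n x)
  have m1 := fun n => memLp_two_of_linear_growth (hF n).continuous.aestronglyMeasurable (hF1 n)
  have m2 := fun n => memLp_two_of_linear_growth
    (continuous_ouExpr (hF n)).aestronglyMeasurable (hF2 n)
  have t1 : Tendsto (fun n => (m1 n).toLp (F n)) atTop (𝓝 (waveL2 ξ)) :=
    tendsto_toLp_of_linear_growth (fun n => (hF n).continuous) (continuous_planeWave ξ) m1 _ hF1
      fun x => (hloc x).mono fun n hn => hn.eq_of_nhds
  have t2 : Tendsto (fun n => (m2 n).toLp (ouExpr (F n))) atTop (𝓝 (ouWaveL2 ξ)) :=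
    tendsto_toLp_of_linear_growth (fun n => continuous_ouExpr (hF n)) (continuous_ouWave ξ) m2 _
      hF2 fun x => (hloc x).mono fun n hn => by rw [ouExpr_congr hn, ouExpr_planeWave]
  refine mem_closure_of_tendsto (t1.prodMk_nhds t2) (Eventually.of_forall fun n => ?_)
  exact ⟨F n, hF n, hFc n, MemLp.coeFn_toLp (m1 n), MemLp.coeFn_toLp (m2 n)⟩

/-! ### The Mehler operators form the semigroup generated by `-L` -/

theorem dense_span_waveL2 (d : ℕ) :
    Dense (Submodule.span ℂ (range (waveL2 : EucSpace d → GaussL2 d)) : Set (GaussL2 d)) := by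
  rw [Submodule.dense_iff_topologicalClosure_eq_top]
  exact span_waveL2_topologicalClosure d

/-- The e^{-2t}|ξ|² from the damping cancels the one from the square. The result is symmetric in ξ
and η, which makes the Mehler operators symmetric, and depends on t only through e^{-t}⟨ξ, η⟩. -/
theorem mehlerDamping_mul_exp {d : ℕ} (t : ℝ) (ξ η : EucSpace d) :
    mehlerDamping t ξ * Real.exp (-‖Real.exp (-t) • ξ - η‖ ^ 2 / 2)
      = Real.exp (-(‖ξ‖ ^ 2 + ‖η‖ ^ 2) / 2 + Real.exp (-t) * ⟪ξ, η⟫) := by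
  have hRr : Real.exp (-2 * t) = Real.exp (-t) ^ 2 := by
    rw [← Real.exp_nat_mul]; ring_nf
  rw [mehlerDamping, ← Real.exp_add, norm_sub_sq_real, norm_smul, real_inner_smul_left, mul_pow,
    Real.norm_eq_abs, sq_abs, hRr]
  congr 1
  ring

theorem mehlerOp_add {d : ℕ} {s t : ℝ} (hs : 0 ≤ s) (ht : 0 ≤ t) :
    mehlerOp d (s + t) = (mehlerOp d s).comp (mehlerOp d t) := by
  refine ContinuousLinearMap.ext_on (dense_span_waveL2 d) ?_
  rintro _ ⟨ξ, rfl⟩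
  rw [ContinuousLinearMap.comp_apply, mehlerOp_waveL2 ht, map_smul, mehlerOp_waveL2 hs,
    mehlerOp_waveL2 (add_nonneg hs ht), smul_smul, smul_smul, ← Complex.ofReal_mul,
    mehlerDamping, mehlerDamping, mehlerDamping, ← Real.exp_add, ← Real.exp_add]
  have e1 : Real.exp (-s + -t) = Real.exp (-(s + t)) := by ring_nf
  have e2 : Real.exp (-2 * (s + t)) = Real.exp (-2 * s) * Real.exp (-2 * t) := by
    rw [← Real.exp_add]; ring_nf
  have e3 : Real.exp (-2 * t) = Real.exp (-t) ^ 2 := by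
    rw [← Real.exp_nat_mul]; ring_nf
  rw [e1, norm_smul, mul_pow, Real.norm_eq_abs, sq_abs, e2, e3]
  congr 3
  ring

theorem inner_mehlerOp_waveL2 {d : ℕ} {t : ℝ} (ht : 0 ≤ t) (η : EucSpace d) (f : GaussL2 d) :
    inner ℂ (mehlerOp d t (waveL2 η)) f = inner ℂ (waveL2 η) (mehlerOp d t f) := by
  have h : innerSL ℂ (mehlerOp d t (waveL2 η))
      = (innerSL ℂ (waveL2 η)).comp (mehlerOp d t) := by
    refine ContinuousLinearMap.ext_on (dense_span_waveL2 d) ?_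
    rintro _ ⟨ξ, rfl⟩
    rw [ContinuousLinearMap.comp_apply, innerSL_apply_apply, innerSL_apply_apply,
      mehlerOp_waveL2 ht, mehlerOp_waveL2 ht, inner_smul_left, inner_smul_right,
      inner_waveL2_waveL2, inner_waveL2_waveL2, Complex.conj_ofReal, ← Complex.ofReal_mul,
      ← Complex.ofReal_mul, norm_sub_rev ξ, mehlerDamping_mul_exp, mehlerDamping_mul_exp,
      real_inner_comm ξ η, add_comm (‖ξ‖ ^ 2)]
  exact DFunLike.congr_fun h f

theorem inner_waveL2_mehlerOp_ouWaveL2 {d : ℕ} {t : ℝ} (ht : 0 ≤ t) (ξ η : EucSpace d) :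
    inner ℂ (waveL2 η) (mehlerOp d t (ouWaveL2 ξ))
      = (Real.exp (-t) * ⟪ξ, η⟫
        * Real.exp (-(‖ξ‖ ^ 2 + ‖η‖ ^ 2) / 2 + Real.exp (-t) * ⟪ξ, η⟫) : ℝ) := by
  rw [← inner_mehlerOp_waveL2 ht, mehlerOp_waveL2 ht, inner_smul_left,
    inner_waveL2_ouWaveL2, Complex.conj_ofReal, ← Complex.ofReal_mul, norm_sub_rev,
    mul_left_comm, mehlerDamping_mul_exp, real_inner_smul_right, real_inner_comm ξ η,
    add_comm (‖ξ‖ ^ 2)]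

/-- Together with `mehlerOp_waveL2` this says that the Mehler operators commute with L on
characters. -/
theorem mehlerOp_ouWaveL2 {d : ℕ} {t : ℝ} (ht : 0 ≤ t) (ξ : EucSpace d) :
    mehlerOp d t (ouWaveL2 ξ) = (mehlerDamping t ξ : ℂ) • ouWaveL2 (Real.exp (-t) • ξ) := by
  refine ext_inner_waveL2 fun η => ?_
  rw [inner_waveL2_mehlerOp_ouWaveL2 ht, inner_smul_right, inner_waveL2_ouWaveL2,
    ← Complex.ofReal_mul, mul_left_comm, mehlerDamping_mul_exp, real_inner_smul_left]

/-! ### Strong continuity. -/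

theorem continuous_waveL2 (d : ℕ) : Continuous (waveL2 : EucSpace d → GaussL2 d) := by
  rw [continuous_iff_continuousAt]
  intro ξ
  rw [ContinuousAt, tendsto_iff_norm_sub_tendsto_zero]
  have h : ∀ η : EucSpace d, ‖waveL2 η - waveL2 ξ‖
      = Real.sqrt (2 - 2 * Real.exp (-‖ξ - η‖ ^ 2 / 2)) := fun η => by
    rw [← Real.sqrt_sq (norm_nonneg (waveL2 η - waveL2 ξ)), @norm_sub_sq ℂ,
      ← inner_self_eq_norm_sq (𝕜 := ℂ), ← inner_self_eq_norm_sq (𝕜 := ℂ), inner_waveL2_waveL2,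
      inner_waveL2_waveL2, inner_waveL2_waveL2]
    simp only [sub_self, norm_zero, RCLike.re_to_complex, Complex.ofReal_re]
    congr 1
    norm_num
    ring
  simp_rw [h]
  have hc : Continuous fun η : EucSpace d => Real.sqrt (2 - 2 * Real.exp (-‖ξ - η‖ ^ 2 / 2)) := by
    fun_prop
  have := hc.tendsto ξ
  simpa using this

theorem continuousOn_mehlerOp {d : ℕ} (f : GaussL2 d) :
    ContinuousOn (fun t : ℝ => mehlerOp d t f) (Ici 0) := by
  have hspan : ∀ g ∈ Submodule.span ℂ (range (waveL2 : EucSpace d → GaussL2 d)),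
      ContinuousOn (fun t : ℝ => mehlerOp d t g) (Ici 0) := by
    intro g hg
    induction hg using Submodule.span_induction with
    | mem x hx =>
      obtain ⟨ξ, rfl⟩ := hx
      have hw := continuous_waveL2 d
      have hc : Continuous fun t : ℝ =>
          (mehlerDamping t ξ : ℂ) • (waveL2 (Real.exp (-t) • ξ) : GaussL2 d) := by
        unfold mehlerDamping
        fun_prop
      exact hc.continuousOn.congr fun t ht => mehlerOp_waveL2 ht ξ
    | zero => simpa using continuousOn_const
    | add x y _ _ hx hy => simp only [map_add]; exact hx.add hy
    | smul a x _ hx => simp only [map_smul]; exact hx.const_smul a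
  -- The orbit of f is approximated by the orbit of some g in the span of the characters, uniformly
  -- for times in [0, t + 1), where the operator norms are at most M.
  refine continuousOn_of_locally_uniform_approx_of_continuousWithinAt fun t ht u hu => ?_
  obtain ⟨ε, hε, hεu⟩ := Metric.mem_uniformity_dist.1 hu
  set M : ℝ := (4 * Real.pi) ^ (d : ℝ) * 2 ^ (d : ℝ) * Real.exp ((t + 1) * d) with hM
  have hpi := Real.pi_pos
  have hM0 : 0 < M := by positivity
  obtain ⟨g, hg, hfg⟩ := Metric.mem_closure_iff.1 (dense_span_waveL2 d f) (ε / M) (by positivity)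
  refine ⟨Ici 0 ∩ Iio (t + 1), inter_mem self_mem_nhdsWithin
    (mem_nhdsWithin_of_mem_nhds (Iio_mem_nhds (lt_add_one t))), fun t => mehlerOp d t g,
    hspan g hg t ht, fun y hy => hεu ?_⟩
  rw [dist_eq_norm, ← map_sub]
  rw [dist_eq_norm, lt_div_iff₀ hM0] at hfg
  refine lt_of_le_of_lt ((mehlerOp d y).le_of_opNorm_le (c := M)
    ((norm_mehlerOp_le hy.1).trans ?_) _) (by rwa [mul_comm])
  have := (mem_Iio.1 hy.2).le
  rw [hM]
  gcongr

theorem isC0Semigroup_mehlerOp (d : ℕ) : IsC0Semigroup (mehlerOp d) where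
  map_zero := mehlerOp_zero d
  map_add _ _ hs ht := mehlerOp_add hs ht
  strongly_continuous := continuousOn_mehlerOp

/-! ### Identification of the generator. -/

theorem intervalIntegrable_mehlerOp {d : ℕ} (f : GaussL2 d) {h : ℝ} (hh : 0 ≤ h) :
    IntervalIntegrable (fun s => mehlerOp d s f) volume 0 h :=
  ((continuousOn_mehlerOp f).mono (by
    rw [uIcc_of_le hh]; exact Icc_subset_Ici_self)).intervalIntegrable

theorem inner_integral_mehlerOp {d : ℕ} (f g : GaussL2 d) {h : ℝ} (hh : 0 ≤ h) :
    inner ℂ g (∫ s in (0 : ℝ)..h, mehlerOp d s f)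
      = ∫ s in (0 : ℝ)..h, inner ℂ g (mehlerOp d s f) := by
  have := (innerSL ℂ g).intervalIntegral_comp_comm (intervalIntegrable_mehlerOp f hh)
  simpa using this.symm

/-- Paired with e_η this is the fundamental theorem of calculus for the scalar function φ, whose
derivative is -⟨e_η, T_s L e_ξ⟩. -/
theorem mehlerOp_waveL2_sub {d : ℕ} (ξ : EucSpace d) {h : ℝ} (hh : 0 ≤ h) :
    mehlerOp d h (waveL2 ξ) - waveL2 ξ = -∫ s in (0 : ℝ)..h, mehlerOp d s (ouWaveL2 ξ) := by
  refine ext_inner_waveL2 fun η => ?_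
  set φ : ℝ → ℝ := fun s =>
    Real.exp (-(‖ξ‖ ^ 2 + ‖η‖ ^ 2) / 2 + Real.exp (-s) * ⟪ξ, η⟫) with hφ
  have h1 : ∀ s, 0 ≤ s → inner ℂ (waveL2 η) (mehlerOp d s (waveL2 ξ)) = (φ s : ℂ) := fun s hs => by
    rw [mehlerOp_waveL2 hs, inner_smul_right, inner_waveL2_waveL2, ← Complex.ofReal_mul,
      mehlerDamping_mul_exp]
  have h2 : ∀ s, HasDerivAt φ (-(Real.exp (-s) * ⟪ξ, η⟫ * φ s)) s := fun s => by
    have e := ((((hasDerivAt_neg s).exp.mul_const ⟪ξ, η⟫).const_add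
      (-(‖ξ‖ ^ 2 + ‖η‖ ^ 2) / 2))).exp
    convert e using 1
    simp only [hφ]
    ring
  have h3 : ∫ s in (0 : ℝ)..h, ((-(Real.exp (-s) * ⟪ξ, η⟫ * φ s) : ℝ) : ℂ)
      = (φ h : ℂ) - (φ 0 : ℂ) := by
    refine intervalIntegral.integral_eq_sub_of_hasDerivAt (f := fun s => (φ s : ℂ))
      (fun s _ => (h2 s).ofReal_comp) (Continuous.intervalIntegrable ?_ _ _)
    simp only [hφ]
    fun_prop
  have h0 := h1 0 le_rfl
  rw [mehlerOp_zero, ContinuousLinearMap.id_apply] at h0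
  rw [inner_sub_right, h1 h hh, h0, ← h3, inner_neg_right, inner_integral_mehlerOp _ _ hh,
    ← intervalIntegral.integral_neg]
  refine intervalIntegral.integral_congr fun s hs => ?_
  rw [uIcc_of_le hh] at hs
  rw [inner_waveL2_mehlerOp_ouWaveL2 hs.1, ← Complex.ofReal_neg]

/-- By duality from the case of characters: T_h is moved onto e_η, the identity for e_η is used, and
⟨T_s L e_η, f⟩ = ⟨T_s e_η, g⟩ because T_s e_η is again a multiple of a character. -/
theorem mehlerOp_sub_of_mem_graph {d : ℕ} {f g : GaussL2 d} (hfg : (f, g) ∈ (ouOperator d).graph)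
    {h : ℝ} (hh : 0 ≤ h) :
    mehlerOp d h f - f = -∫ s in (0 : ℝ)..h, mehlerOp d s g := by
  rw [graph_ouOperator] at hfg
  refine ext_inner_waveL2 fun η => ?_
  have h1 : inner ℂ (waveL2 η) (mehlerOp d h f - f)
      = inner ℂ (mehlerOp d h (waveL2 η) - waveL2 η) f := by
    rw [inner_sub_right, inner_sub_left, inner_mehlerOp_waveL2 hh]
  rw [h1, mehlerOp_waveL2_sub η hh, inner_neg_left, inner_neg_right, inner_integral_mehlerOp _ _ hh,
    ← inner_conj_symm, inner_integral_mehlerOp _ _ hh, intervalIntegral.integral_of_le hh,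
    intervalIntegral.integral_of_le hh, ← integral_conj]
  congr 1
  refine setIntegral_congr_fun measurableSet_Ioc fun s hs => ?_
  have hs0 : 0 ≤ s := hs.1.le
  rw [inner_conj_symm, ← inner_mehlerOp_waveL2 hs0, mehlerOp_waveL2 hs0, mehlerOp_ouWaveL2 hs0,
    inner_smul_left, inner_smul_left, inner_waveL2_eq_of_mem_closure hfg]

theorem integral_mehlerOp_waveL2_mem_graph {d : ℕ} (ξ : EucSpace d) {h : ℝ} (hh : 0 < h) :
    (∫ s in (0 : ℝ)..h, mehlerOp d s (waveL2 ξ), waveL2 ξ - mehlerOp d h (waveL2 ξ))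
      ∈ (ouCoreGraph d).topologicalClosure := by
  set G := (ouCoreGraph d).topologicalClosure with hG
  have h1 : waveL2 ξ - mehlerOp d h (waveL2 ξ) = ∫ s in (0 : ℝ)..h, mehlerOp d s (ouWaveL2 ξ) := by
    rw [← neg_sub, mehlerOp_waveL2_sub ξ hh.le, neg_neg]
  have hi1 := (intervalIntegrable_mehlerOp (waveL2 ξ) hh.le).1
  have hi2 := (intervalIntegrable_mehlerOp (ouWaveL2 ξ) hh.le).1
  have hmem : ∀ s, 0 ≤ s → (mehlerOp d s (waveL2 ξ), mehlerOp d s (ouWaveL2 ξ)) ∈ G :=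
    fun s hs => by
      rw [mehlerOp_waveL2 hs, mehlerOp_ouWaveL2 hs, ← Prod.smul_mk]
      have hw := waveL2_mem_graph (Real.exp (-s) • ξ)
      rw [graph_ouOperator] at hw
      exact G.smul_mem _ hw
  -- The closed subspace G contains (T_s e_ξ, T_s L e_ξ) for every s ≥ 0, hence also its average
  -- over (0, h]; multiplying by h gives the integral.
  have havg := (G.restrictScalars ℝ).convex.set_average_mem (s := (G : Set _))
    (μ := (volume : Measure ℝ)) (t := Ioc 0 h)
    (f := fun s => (mehlerOp d s (waveL2 ξ), mehlerOp d s (ouWaveL2 ξ)))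
    (Submodule.isClosed_topologicalClosure _) (by simp [hh]) (by simp)
    ((ae_restrict_iff' measurableSet_Ioc).2 (Eventually.of_forall fun s hs => hmem s hs.1.le))
    (hi1.prodMk hi2)
  have h2 := (G.restrictScalars ℝ).smul_mem h havg
  rw [setAverage_eq, smul_smul] at h2
  have h3 : h * (volume.real (Ioc (0 : ℝ) h))⁻¹ = 1 := by
    simp [hh.le, hh.ne']
  rw [h3, one_smul, integral_pair hi1 hi2] at h2
  rw [h1, intervalIntegral.integral_of_le hh.le, intervalIntegral.integral_of_le hh.le]
  exact h2

theorem exists_integral_mehlerOp_clm (d : ℕ) {h : ℝ} (hh : 0 ≤ h) :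
    ∃ J : GaussL2 d →L[ℂ] GaussL2 d, ∀ f, J f = ∫ s in (0 : ℝ)..h, mehlerOp d s f := by
  obtain ⟨M, hM0, hM⟩ := (isC0Semigroup_mehlerOp d).bounded_Icc h
  refine ⟨LinearMap.mkContinuous
    { toFun := fun f => ∫ s in (0 : ℝ)..h, mehlerOp d s f
      map_add' := fun f g => ?_
      map_smul' := fun c f => ?_ } (M * |h - 0|) fun f => ?_, fun f => rfl⟩
  · simp only [map_add]
    exact intervalIntegral.integral_add (intervalIntegrable_mehlerOp f hh)
      (intervalIntegrable_mehlerOp g hh)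
  · simp only [map_smul, RingHom.id_apply]
    exact intervalIntegral.integral_smul _ _
  · simp only [LinearMap.coe_mk, AddHom.coe_mk]
    refine (intervalIntegral.norm_integral_le_of_norm_le_const (C := M * ‖f‖)
      fun s hs => ?_).trans (le_of_eq (by ring))
    rw [uIoc_of_le hh] at hs
    exact (mehlerOp d s).le_of_opNorm_le (hM s ⟨hs.1.le, hs.2⟩) f

theorem integral_mehlerOp_mem_graph {d : ℕ} (f : GaussL2 d) {h : ℝ} (hh : 0 < h) :
    (∫ s in (0 : ℝ)..h, mehlerOp d s f, f - mehlerOp d h f) ∈ (ouOperator d).graph := by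
  rw [graph_ouOperator]
  obtain ⟨J, hJ⟩ := exists_integral_mehlerOp_clm d hh.le
  set G := (ouCoreGraph d).topologicalClosure with hG
  set Φ : GaussL2 d →L[ℂ] GaussL2 d × GaussL2 d :=
    J.prod (ContinuousLinearMap.id ℂ _ - mehlerOp d h) with hΦ
  -- Both components depend continuously on f, so the good f form a closed subspace; it contains the
  -- characters and is therefore everything.
  have hcl : IsClosed ((G.comap Φ.toLinearMap : Submodule ℂ (GaussL2 d)) : Set (GaussL2 d)) :=
    (Submodule.isClosed_topologicalClosure _).preimage Φ.continuous
  have hle : Submodule.span ℂ (range (waveL2 : EucSpace d → GaussL2 d))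
      ≤ G.comap Φ.toLinearMap := by
    rw [Submodule.span_le]
    rintro _ ⟨ξ, rfl⟩
    have := integral_mehlerOp_waveL2_mem_graph ξ hh
    rw [← hJ] at this
    exact this
  have htop := Submodule.topologicalClosure_minimal _ hle hcl
  rw [span_waveL2_topologicalClosure] at htop
  have hf : Φ f ∈ G := htop (Submodule.mem_top (x := f))
  rw [← hJ]
  exact hf

theorem mem_graph_neg_ouOperator {d : ℕ} (f g : GaussL2 d) :
    (f, g) ∈ (-ouOperator d).graph ↔ (f, -g) ∈ (ouOperator d).graph := by
  rw [LinearPMap.neg_graph, Submodule.mem_map]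
  constructor
  · rintro ⟨⟨a, b⟩, hu, h⟩
    have h1 : a = f := congrArg Prod.fst h
    have h2 : -b = g := congrArg Prod.snd h
    rwa [← h1, ← h2, neg_neg]
  · intro h
    exact ⟨(f, -g), h, Prod.ext rfl (neg_neg g)⟩

theorem isGeneratorOf_mehlerOp (d : ℕ) : IsGeneratorOf (-ouOperator d) (mehlerOp d) := by
  intro f g
  have havg : ∀ u : GaussL2 d, Tendsto (fun t : ℝ => t⁻¹ • ∫ s in (0 : ℝ)..t, mehlerOp d s u)
      (𝓝[>] 0) (𝓝 u) := fun u => by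
    have := tendsto_average_right (continuousOn_mehlerOp u) le_rfl
    simp only [zero_add, mehlerOp_zero] at this
    exact this
  rw [mem_graph_neg_ouOperator]
  constructor
  · intro h
    refine (havg g).congr' ?_
    filter_upwards [self_mem_nhdsWithin] with t ht
    have h1 := mehlerOp_sub_of_mem_graph h (le_of_lt ht)
    simp only [map_neg, intervalIntegral.integral_neg, neg_neg] at h1
    rw [h1]
    rfl
  · intro h
    -- The pairs (t⁻¹∫₀ᵗ T_s f ds, t⁻¹(f - T_t f)) lie in the closed graph of L and converge to (f,
    -- -g).
    have hlim := (havg f).prodMk_nhds h.neg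
    rw [graph_ouOperator]
    refine (Submodule.isClosed_topologicalClosure (ouCoreGraph d)).mem_of_tendsto hlim ?_
    filter_upwards [self_mem_nhdsWithin] with t ht
    have h1 := integral_mehlerOp_mem_graph f ht
    rw [graph_ouOperator] at h1
    have h2 := ((ouCoreGraph d).topologicalClosure.restrictScalars ℝ).smul_mem t⁻¹ h1
    rw [Prod.smul_mk] at h2
    have h3 : t⁻¹ • (f - mehlerOp d t f) = -(t⁻¹ • (mehlerOp d t f - f)) := by
      rw [← smul_neg, neg_sub]
    rw [h3] at h2
    exact h2

theorem isC0SemigroupGeneratedBy_mehlerOp (d : ℕ) :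
    IsC0SemigroupGeneratedBy (mehlerOp d) (-ouOperator d) :=
  ⟨isC0Semigroup_mehlerOp d, isGeneratorOf_mehlerOp d⟩

theorem ouSemigroup_eq_mehlerOp {d : ℕ} {t : ℝ} (ht : 0 ≤ t) :
    ouSemigroup d t = mehlerOp d t :=
  (expSemigroup_spec (isC0SemigroupGeneratedBy_mehlerOp d)).unique
    (isC0SemigroupGeneratedBy_mehlerOp d) ht

/-! ### Boundedness from `L^p` to `L^2` -/

theorem isBoundedLpToL2_ouSemigroup {d : ℕ} {t : ℝ} (ht : 0 < t) {p : ℝ≥0∞} [Fact (1 ≤ p)]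
    (hp2 : p ≤ 2) {K : ℝ} (hK : ouBound d (1 / p.toReal) t ≤ K) :
    IsBoundedLpToL2 (ouSemigroup d t) p (ouAlpha p t) K := by
  have hp : 1 ≤ p := Fact.out
  have hp0 : 0 < p.toReal :=
    ENNReal.toReal_pos (zero_lt_one.trans_le hp).ne' (ne_top_of_le_ne_top (by simp) hp2)
  have hα : 0 < ouAlpha p t := by unfold ouAlpha; positivity
  obtain ⟨S, hS, hS2⟩ := exists_mehler_clm (d := d) ht hp2
    (absolutelyContinuous_gaussMeasure hα) zero_le_one (fun f => by simp)
  refine ⟨S, hS.trans (by rwa [mul_one]), fun g f hgf => ?_⟩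
  rw [ouSemigroup_eq_mehlerOp ht.le]
  refine Lp.ext ((hS2 g).trans ?_)
  rw [mehlerIntegral_congr hgf]
  exact (coeFn_mehlerOp ht f).symm

theorem ouBound_one_le {d : ℕ} {t : ℝ} (ht : 0 < t) :
    ouBound d 1 t ≤ (4 * Real.pi) ^ (d : ℝ) * 2 ^ ((d : ℝ) / 4)
      * (1 - Real.exp (-4 * t)) ^ (-((d : ℝ) / 4)) := by
  have h1 := one_sub_exp_pos ht
  have hpi := Real.pi_pos
  have hd : (0 : ℝ) ≤ d := Nat.cast_nonneg d
  have hR : 0 < Real.exp (-2 * t) := Real.exp_pos _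
  have e4 : Real.exp (-4 * t) = Real.exp (-2 * t) ^ 2 := by
    rw [← Real.exp_nat_mul]; ring_nf
  have e : (1 - Real.exp (-2 * t)) ^ (-((d : ℝ) / 4))
      ≤ 2 ^ ((d : ℝ) / 4) * (1 - Real.exp (-4 * t)) ^ (-((d : ℝ) / 4)) := by
    have hpos : 0 < 1 - Real.exp (-4 * t) := by
      rw [e4]; nlinarith
    -- From 1 - R² = (1 - R)(1 + R) ≤ 2(1 - R) with R = e^{-2t}; this is the source of the factor
    -- 2^(d/4).
    have hle : (1 - Real.exp (-4 * t)) / 2 ≤ 1 - Real.exp (-2 * t) := by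
      rw [e4]; nlinarith
    refine (Real.rpow_le_rpow_of_nonpos (by positivity) hle (by linarith)).trans (le_of_eq ?_)
    rw [Real.div_rpow hpos.le zero_le_two, Real.rpow_neg zero_le_two, div_inv_eq_mul, mul_comm]
  rw [ouBound]
  have e2 : -((d : ℝ) / 2 * (1 - 1 / 2)) = -((d : ℝ) / 4) := by ring
  rw [e2, sub_self, mul_zero, mul_zero, Real.exp_zero, mul_one, mul_assoc]
  gcongr

theorem ouBound_le_of_small {d : ℕ} {s t : ℝ} (hs : 1 / 2 ≤ s) (hs1 : s ≤ 1) (ht : 0 < t)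
    (ht1 : t < 1 / 2) :
    ouBound d s t ≤ (4 * Real.pi) ^ (d : ℝ) * Real.exp (d * (1 - s))
      * t ^ (-((d : ℝ) / 2 * (s - 1 / 2))) := by
  have hpi := Real.pi_pos
  have hd : (0 : ℝ) ≤ d := Nat.cast_nonneg d
  -- Since e^{-2t} ≤ 1/(1 + 2t), it suffices that (1 - t)(1 + 2t) ≥ 1, that is t ≤ 1/2; this fixes
  -- the range of small times.
  have hle : t ≤ 1 - Real.exp (-2 * t) := by
    have h1 : Real.exp (-2 * t) ≤ 1 / (1 + 2 * t) := by
      rw [neg_mul, Real.exp_neg, ← one_div]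
      refine one_div_le_one_div_of_le (by positivity) ?_
      linarith [Real.add_one_le_exp (2 * t)]
    have h2 : 1 / (1 + 2 * t) ≤ 1 - t := by
      rw [div_le_iff₀ (by positivity)]
      nlinarith
    linarith
  have hexp : t * (d * (1 - s)) ≤ d * (1 - s) :=
    mul_le_of_le_one_left (mul_nonneg hd (by linarith)) (by linarith)
  have hθ : -((d : ℝ) / 2 * (s - 1 / 2)) ≤ 0 := by
    have : 0 ≤ (d : ℝ) / 2 * (s - 1 / 2) := mul_nonneg (by positivity) (by linarith)
    linarith
  rw [ouBound]
  have hpos := one_sub_exp_pos ht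
  have := Real.rpow_le_rpow_of_nonpos ht hle hθ
  gcongr

theorem mainTheorem5 (d : ℕ) :
    IsC0SemigroupGeneratedBy (ouSemigroup d) (-ouOperator d) ∧
    (∃ C : ℝ, ∀ t : ℝ, 0 < t →
      IsBoundedLpToL2 (ouSemigroup d t) 1 (ouAlpha 1 t)
        (C * (1 - Real.exp (-4 * t)) ^ (-((d : ℝ) / 4)))) ∧
    (∀ (p : ℝ≥0∞) [Fact (1 ≤ p)], p ≤ 2 →
      (∀ t : ℝ, 0 < t → ∃ K : ℝ, IsBoundedLpToL2 (ouSemigroup d t) p (ouAlpha p t) K) ∧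
      ∃ C : ℝ, ∀ᶠ t : ℝ in 𝓝[>] 0,
        IsBoundedLpToL2 (ouSemigroup d t) p (ouAlpha p t)
          (C * t ^ (-((d : ℝ) / 2 * (1 / p.toReal - 1 / 2))))) := by
  refine ⟨expSemigroup_spec (isC0SemigroupGeneratedBy_mehlerOp d),
    ⟨(4 * Real.pi) ^ (d : ℝ) * 2 ^ ((d : ℝ) / 4), fun t ht =>
      isBoundedLpToL2_ouSemigroup ht one_le_two ?_⟩, fun p hpf hp2 => ⟨fun t ht =>
      ⟨_, isBoundedLpToL2_ouSemigroup ht hp2 le_rfl⟩, ?_⟩⟩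
  · rw [ENNReal.toReal_one, div_one]
    exact ouBound_one_le ht
  · have hp : 1 ≤ p := hpf.out
    have hpt : p ≠ ∞ := ne_top_of_le_ne_top (by simp) hp2
    have hp1' : 1 ≤ p.toReal := by
      simpa using (ENNReal.toReal_le_toReal (by simp) hpt).2 hp
    have hp2' : p.toReal ≤ 2 := by
      simpa using (ENNReal.toReal_le_toReal hpt (by simp)).2 hp2
    have hp0 : 0 < p.toReal := by linarith
    refine ⟨(4 * Real.pi) ^ (d : ℝ) * Real.exp (d * (1 - 1 / p.toReal)), ?_⟩
    filter_upwards [Ioo_mem_nhdsGT (show (0 : ℝ) < 1 / 2 by norm_num)] with t ht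
    exact isBoundedLpToL2_ouSemigroup ht.1 hp2 (ouBound_le_of_small
      (one_div_le_one_div_of_le hp0 hp2') ((div_le_one hp0).2 hp1') ht.1 ht.2)
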